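/- A web is a finite trivalent graph (multiple edges are allowed) embedded in the two-sphere $S^2$, with oriented edges, such that every vertex is a source or a sink. For a web $\Gamma$ with set of edges $E$, the group $\pi_1(S^3-\Gamma)$ is generated by one meridian $x_e$ for each edge $e$, with one relation at each vertex: the product, in the planar cyclic order, of the three meridians of the incident edges is trivial. Let $R(\Gamma)$ be the set of homomorphisms $\rho:\pi_1(S^3-\Gamma)\to SU(3)$ such that $\rho(x_e)$ has trace $-1$ for all $e\in E$. Assigning to each edge $e$ the line in $\mathbb{C}^3$ that is the $(+1)$-eigenspace of $\rho(x_e)$ identifies $R(\Gamma)$ with a subset of $\mathbb{C}P(2)^E$. Give it the real Zariski topology, whose closed sets are defined by polynomials in the homogeneous coordinates and their complex conjugates. A component of $R(\Gamma)$ means an irreducible component in this topology. A square $S$ of $\Gamma$ is a face with four sides. Let $a_1,a_2,a_3,a_4$ be the edges adjoining $S$ at its four corners, listed in cyclic order, and let $Ev_S:R(\Gamma)\to\mathbb{C}P(2)^4$ send a representation to the lines assigned to $a_1,a_2,a_3,a_4$. Put $$\Delta_v=\{(p,p,q,q)\},\qquad \Delta_h=\{(p,q,q,p)\},\qquad \delta=\{(p,p,p,p)\}\qquad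 (p,q\in\mathbb{C}P(2)).$$ A component $C$ of $R(\Gamma)$ is big with respect to $S$ if $Ev_S(C)=\Delta_v$ or $Ev_S(C)=\Delta_h$. The square $S$ is separating if, for some $i\neq j$, the edges $a_i$ and $a_j$ form an isthmus, that is, there is a disk in $S^2$ whose boundary circle meets $\Gamma$ transversely in exactly two points, one in the interior of $a_i$ and one in the interior of $a_j$ (this includes the case in which $a_i$ and $a_j$ are the same edge, which the circle then crosses twice). Proposition. Let $\Gamma$ be a connected web, and suppose that $\Gamma$ has a square $S$. (1) If $S$ is separating, then one of the two sets $\Delta_v,\Delta_h$, call it $\Delta$, is the image $Ev_S(C)$ of a component $C$ of $R(\Gamma)$ that is big with respect to $S$, and the other one, $\Delta'$, satisfies $\Delta'\cap Ev_S(R(\Gamma))=\delta$. (2) If $S$ is nonseparating, then each of $\Delta_h$ and $\Delta_v$ is the image $Ev_S(C)$ of at least one component $C$ of $R(\Gamma)$ that is big with respect to $S$. -/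

import Mathlib

open scoped LinearAlgebra.Projectivization ComplexConjugate

/-- A connected planar web with at least one vertex, presented by its combinatorial map (rotation
system) on the finite set `D` of darts (half-edges): `rot` sends a dart to the next dart,
counterclockwise, around the same vertex, and `flip` sends a dart to the other half of its edge.
The vertices, edges and faces are the cycles of `rot`, of `flip` and of `rot ∘ flip`.
A dart `d` is `out` if its edge is oriented away from the vertex of `d`. -/
structure ConnectedWeb (D : Type*) where
  rot : Equiv.Perm D
  flip : Equiv.Perm D
  /-- every vertex is trivalent -/
  rot_ne : ∀ d, rot d ≠ d
  rot_rot_rot : ∀ d, rot (rot (rot d)) = d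
  /-- every edge consists of two darts -/
  flip_ne : ∀ d, flip d ≠ d
  flip_flip : ∀ d, flip (flip d) = d
  out : D → Bool
  /-- each edge leaves one of its ends and enters the other one -/
  out_flip : ∀ d, out (flip d) = !out d
  /-- every vertex is a source or a sink -/
  out_rot : ∀ d, out (rot d) = out d
  connected : ∀ d d', ∃ g ∈ Subgroup.closure ({rot, flip} : Set (Equiv.Perm D)), g d = d'
  /-- the surface carrying the cellulation is the sphere: `V - E + F = 2` -/
  euler : Nat.card (Quotient (Equiv.Perm.SameCycle.setoid rot))
      + Nat.card (Quotient (Equiv.Perm.SameCycle.setoid (rot * flip)))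
      = Nat.card (Quotient (Equiv.Perm.SameCycle.setoid flip)) + 2

/-- The complex projective plane. -/
abbrev CP2 : Type := ℙ ℂ (Fin 3 → ℂ)

/-- The group `SU(3)`. -/
abbrev SU3 : Type := Matrix.specialUnitaryGroup (Fin 3) ℂ

/-- The real Zariski topology on `CP(2)^E`: the topology whose closed sets are generated by the zero
loci of polynomials in the homogeneous coordinates of the factors and in their complex conjugates.
A polynomial vanishes at a point if it vanishes at all homogeneous coordinates of that point. -/
@[reducible] def zariskiTopology (E : Type*) : TopologicalSpace (E → CP2) :=
  TopologicalSpace.generateFrom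
    {U | ∃ p : MvPolynomial ((E × Fin 3) ⊕ (E × Fin 3)) ℂ,
      U = {l : E → CP2 | ∀ v : E → Fin 3 → ℂ, ∀ hv : ∀ e, v e ≠ 0,
        (∀ e, l e = Projectivization.mk ℂ (v e) (hv e)) →
        MvPolynomial.eval
          (Sum.elim (fun x => v x.1 x.2) (fun x => conj (v x.1 x.2))) p = 0}ᶜ}

/-- The component `Δ_v` of the large diagonal of `CP(2)^4`. -/
def largeDiagV : Set (Fin 4 → CP2) := {x | ∃ u v : CP2, x = ![u, u, v, v]}

/-- The component `Δ_h` of the large diagonal of `CP(2)^4`. -/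
def largeDiagH : Set (Fin 4 → CP2) := {x | ∃ u v : CP2, x = ![u, v, v, u]}

/-- The small diagonal `δ` of `CP(2)^4`. -/
def smallDiag : Set (Fin 4 → CP2) := {x | ∃ u : CP2, x = ![u, u, u, u]}

namespace ConnectedWeb

variable {D : Type*} (Γ : ConnectedWeb D)

/-- The edges of the web. -/
abbrev Edge : Type _ := Quotient (Equiv.Perm.SameCycle.setoid Γ.flip)

/-- The edge containing a dart. -/
def edge (d : D) : Γ.Edge := Quotient.mk _ d

/-- Walking along the boundary of the face to the right of a dart: go to the other end of its edge
and turn right. -/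
def next : Equiv.Perm D := Γ.rot * Γ.flip

/-- The faces of the web. -/
abbrev Face : Type _ := Quotient (Equiv.Perm.SameCycle.setoid Γ.next)

/-- The face to the right of a dart (looking along the dart away from its vertex). -/
def face (d : D) : Γ.Face := Quotient.mk _ d

/-- The Wirtinger relators. At a sink, the relator is the product of the meridians of the three
incident edges in counterclockwise order; at a source, it is their product in clockwise order. -/
def relators : Set (FreeGroup Γ.Edge) :=
  {r | ∃ d : D,
    (Γ.out d = false ∧
      r = FreeGroup.of (Γ.edge d) * FreeGroup.of (Γ.edge (Γ.rot d))
        * FreeGroup.of (Γ.edge (Γ.rot (Γ.rot d)))) ∨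
    (Γ.out d = true ∧
      r = FreeGroup.of (Γ.edge (Γ.rot (Γ.rot d))) * FreeGroup.of (Γ.edge (Γ.rot d))
        * FreeGroup.of (Γ.edge d))}

/-- The fundamental group of the complement of the web in the three-sphere, by its Wirtinger
presentation: one generator (meridian) for each edge, one relator for each vertex. -/
abbrev WebGroup : Type _ := PresentedGroup Γ.relators

/-- The meridian of an edge. -/
def meridian (e : Γ.Edge) : Γ.WebGroup := PresentedGroup.of e

/-- The representation variety `R(Γ)`: homomorphisms from the web group to `SU(3)` that send all
meridians to matrices of trace `-1`. It is regarded as a subset of `CP(2)^E`: such a homomorphism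
is determined by the lines assigned to the edges, where the line assigned to an edge is the
eigenspace for the eigenvalue `1` of the image of the meridian of that edge. -/
def R : Type _ :=
  {l : Γ.Edge → CP2 // ∃ ρ : Γ.WebGroup →* SU3, ∀ e : Γ.Edge,
    Matrix.trace (ρ (Γ.meridian e) : Matrix (Fin 3) (Fin 3) ℂ) = -1 ∧
    Module.End.eigenspace
      (Matrix.toLin' (ρ (Γ.meridian e) : Matrix (Fin 3) (Fin 3) ℂ)) 1 = (l e).submodule}

/-- `R(Γ)` carries the Zariski topology. -/
instance : TopologicalSpace Γ.R :=
  TopologicalSpace.induced Subtype.val (zariskiTopology Γ.Edge)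

/-- A square of the web: a face with four sides, with one of its sides chosen as the first one. -/
structure Square where
  base : D
  four_sides : Function.minimalPeriod Γ.next base = 4

/-- The edges of `d` and `d'` form an isthmus: some circle in the sphere meets the web transversely
in exactly two points, one in the interior of each of the two edges. Such a circle crosses from one
face to another along the first edge and back along the second one, so it exists if and only if
the two edges have the same two faces on their sides. (The two edges are allowed to be equal; the
circle then crosses this edge twice.) -/
def IsIsthmus (d d' : D) : Prop :=
  s(Γ.face d, Γ.face (Γ.flip d)) = s(Γ.face d', Γ.face (Γ.flip d'))

variable {Γ}

namespace Square

variable (S : Γ.Square)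

/-- At the `i`-th corner of the square, the dart that is not on the boundary of the square. The
sides at this corner are `next ^ i base` and `rot⁻¹ (next ^ i base)`. -/
def diagonal (i : Fin 4) : D := Γ.rot ((Γ.next ^ (i : ℕ)) S.base)

/-- The square is separating: the edges adjoining it at two different corners form an isthmus. -/
def IsSeparating : Prop :=
  ∃ i j : Fin 4, i ≠ j ∧ Γ.IsIsthmus (S.diagonal i) (S.diagonal j)

/-- The map `Ev_S : R(Γ) → CP(2)^4` that evaluates at the four edges adjoining the square, in their
cyclic order. -/
def ev (ρ : Γ.R) : Fin 4 → CP2 := fun i => ρ.1 (Γ.edge (S.diagonal i))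

/-- A subset of `R(Γ)` is big with respect to the square if its image under `Ev_S` is one of the
two components of the large diagonal. -/
def IsBig (C : Set Γ.R) : Prop := S.ev '' C = largeDiagV ∨ S.ev '' C = largeDiagH

end Square

end ConnectedWeb

/-! An element of SU(3) of trace -1 that fixes exactly a line is 2P - 1, with P the projection onto
that line, and three such reflections multiply to 1 exactly when their lines are orthogonal, in
which case P₁ + P₂ + P₃ = 1. So a point of R(Γ) is an assignment of lines to edges that is
orthogonal at every vertex (`R.orthogonal`, `exists_hom_of_orthogonal`).

Upper bound. Two opposite sides of the square are both orthogonal to the other two, which forces one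
pair of opposite sides to carry equal lines; hence `ev` always lands in Δ_v or Δ_h (`ev_mem`). Both
conditions are closed, so each irreducible set maps into one of the two. The entries of P - 1/3 form
a flow conserved at each vertex. On the sphere a flow is the difference of a potential on the faces
(`IsFlow.exists_faceFlow_eq`, from Euler's formula), so edges forming an isthmus carry the same line
(`line_eq_of_face_eq`). This confines `ev` to a single Δ when the square is separating.

Lower bound. The constant flow 1 mod 3 has a potential, a 3-colouring of the faces; giving each edge
the colour missing from its two faces and each colour a vector of an orthogonal frame yields a point
of R(Γ). The boundary of a face N alternates between the two colours other than that of N. Rotating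
the frame in their plane along this boundary only (a Kempe move) keeps all vertices orthogonal. With
N a neighbour of the square, this moves the diagonals bordering N independently of the others and
sweeps out all of Δ_v or Δ_h. The family is real analytic over an open set of parameters, hence
irreducible, and the component containing it is big.

The square is separating exactly when two opposite neighbours coincide (`isSeparating_iff`), and by
a Jordan curve argument this cannot happen for both pairs (`nbr_ne_of_nbr_eq`). -/

theorem Equiv.Perm.SameCycle.apply_eq {α β : Type*} {f : Equiv.Perm α} {φ : α → β}
    (h : ∀ x, φ (f x) = φ x) {x y : α} (hxy : f.SameCycle x y) : φ x = φ y := by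
  obtain ⟨i, rfl⟩ := hxy
  induction i using Int.induction_on with
  | zero => rfl
  | succ n ih => rw [add_comm, zpow_add, zpow_one, Equiv.Perm.mul_apply, h]; exact ih
  | pred n ih =>
    rw [ih, ← h ((f ^ (-(n : ℤ) - 1)) x), ← Equiv.Perm.mul_apply, ← zpow_one_add]
    congr 3
    ring

/-! ### Darts, edges and vertices of the combinatorial map. -/

namespace ConnectedWeb

variable {D : Type*} (Γ : ConnectedWeb D)

/-- The form in which connectedness is used: it bounds both kernels in the dimension count below. -/
theorem eq_of_invariant {β : Type*} (φ : D → β) (hrot : ∀ d, φ (Γ.rot d) = φ d)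
    (hflip : ∀ d, φ (Γ.flip d) = φ d) (d d' : D) : φ d = φ d' := by
  obtain ⟨g, hg, rfl⟩ := Γ.connected d d'
  have key : ∀ x, φ (g x) = φ x := by
    induction hg using Subgroup.closure_induction with
    | mem g hg =>
      rcases hg with rfl | rfl
      · exact hrot
      · exact hflip
    | one => exact fun _ => rfl
    | mul g g' _ _ h h' => intro x; rw [Equiv.Perm.mul_apply, h, h']
    | inv g _ h => intro x; rw [← h (g⁻¹ x), ← Equiv.Perm.mul_apply, mul_inv_cancel, Equiv.Perm.one_apply]
  exact (key d).symm

theorem sameCycle_flip_iff {d d' : D} : Γ.flip.SameCycle d d' ↔ d' = d ∨ d' = Γ.flip d := by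
  constructor
  · intro h
    have := h.apply_eq (φ := fun x => (x = d ∨ x = Γ.flip d)) (fun x => by
      refine propext ⟨?_, ?_⟩
      · rintro (h | h)
        · right; rw [← h, Γ.flip_flip]
        · left; exact Γ.flip.injective h
      · rintro (rfl | rfl)
        · exact Or.inr rfl
        · exact Or.inl (Γ.flip_flip _))
    exact this.mp (Or.inl rfl)
  · rintro (rfl | rfl)
    · exact .refl _ _
    · exact ⟨1, rfl⟩

theorem sameCycle_rot_iff {d d' : D} :
    Γ.rot.SameCycle d d' ↔ d' = d ∨ d' = Γ.rot d ∨ d' = Γ.rot (Γ.rot d) := by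
  constructor
  · intro h
    have := h.apply_eq (φ := fun x => (x = d ∨ x = Γ.rot d ∨ x = Γ.rot (Γ.rot d))) (fun x => by
      refine propext ⟨?_, ?_⟩
      · rintro (h | h | h)
        · right; right; apply Γ.rot.injective; rw [h, Γ.rot_rot_rot]
        · left; exact Γ.rot.injective h
        · right; left; exact Γ.rot.injective h
      · rintro (rfl | rfl | rfl)
        · exact Or.inr (Or.inl rfl)
        · exact Or.inr (Or.inr rfl)
        · exact Or.inl (Γ.rot_rot_rot _))
    exact this.mp (Or.inl rfl)
  · rintro (rfl | rfl | rfl)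
    · exact .refl _ _
    · exact ⟨1, rfl⟩
    · exact ⟨2, rfl⟩

/-- The vertices of the web. -/
abbrev Vertex : Type _ := Quotient (Equiv.Perm.SameCycle.setoid Γ.rot)

/-- The vertex of a dart. -/
def vertex (d : D) : Γ.Vertex := Quotient.mk _ d

theorem edge_eq_iff {d d' : D} : Γ.edge d = Γ.edge d' ↔ d' = d ∨ d' = Γ.flip d :=
  Quotient.eq.trans Γ.sameCycle_flip_iff

theorem vertex_eq_iff {d d' : D} :
    Γ.vertex d = Γ.vertex d' ↔ d' = d ∨ d' = Γ.rot d ∨ d' = Γ.rot (Γ.rot d) :=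
  Quotient.eq.trans Γ.sameCycle_rot_iff

@[simp] theorem edge_flip (d : D) : Γ.edge (Γ.flip d) = Γ.edge d :=
  (Γ.edge_eq_iff.2 (Or.inr rfl)).symm

@[simp] theorem vertex_rot (d : D) : Γ.vertex (Γ.rot d) = Γ.vertex d :=
  (Γ.vertex_eq_iff.2 (Or.inr (Or.inl rfl))).symm

@[simp] theorem face_next (d : D) : Γ.face (Γ.next d) = Γ.face d :=
  (Quotient.sound (s := Equiv.Perm.SameCycle.setoid Γ.next) ⟨1, rfl⟩).symm

@[simp] theorem face_flip (d : D) : Γ.face (Γ.flip d) = Γ.face (Γ.rot d) := by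
  rw [← Γ.face_next (Γ.flip d), next, Equiv.Perm.mul_apply, Γ.flip_flip]

theorem rot_rot_ne (d : D) : Γ.rot (Γ.rot d) ≠ d := fun h =>
  Γ.rot_ne d (by conv_lhs => rw [← h, Γ.rot_rot_rot])

theorem exists_out (e : Γ.Edge) : ∃ d, Γ.out d = true ∧ Γ.edge d = e := by
  induction e using Quotient.inductionOn with | _ d => ?_
  cases h : Γ.out d with
  | true => exact ⟨d, h, rfl⟩
  | false => exact ⟨Γ.flip d, by rw [Γ.out_flip, h]; rfl, Γ.edge_flip d⟩

/-- The dart of an edge that points along the orientation. -/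
noncomputable def outDart (e : Γ.Edge) : D := (Γ.exists_out e).choose

theorem out_outDart (e : Γ.Edge) : Γ.out (Γ.outDart e) = true := (Γ.exists_out e).choose_spec.1

theorem edge_outDart (e : Γ.Edge) : Γ.edge (Γ.outDart e) = e := (Γ.exists_out e).choose_spec.2

theorem outDart_edge {d : D} (hd : Γ.out d = true) : Γ.outDart (Γ.edge d) = d := by
  rcases Γ.edge_eq_iff.1 (Γ.edge_outDart (Γ.edge d)) with h | h
  · exact h.symm
  · rw [h, Γ.out_flip, Γ.out_outDart] at hd
    exact absurd hd (by simp)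

/-! ### Flows, face potentials and the first cohomology of the sphere. -/

section Cohomology

variable {K : Type*} [Field K]

/-- A flow on the edges, conserved at every vertex of the web (where the edges are all incoming
or all outgoing). -/
def IsFlow (f : Γ.Edge → K) : Prop :=
  ∀ d, f (Γ.edge d) + f (Γ.edge (Γ.rot d)) + f (Γ.edge (Γ.rot (Γ.rot d))) = 0

/-- The flow defined by a function on the faces. -/
noncomputable def faceFlow : (Γ.Face → K) →ₗ[K] (Γ.Edge → K) where
  toFun h e := h (Γ.face (Γ.flip (Γ.outDart e))) - h (Γ.face (Γ.outDart e))
  map_add' h h' := by ext e; simp only [Pi.add_apply]; ring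
  map_smul' a h := by ext e; simp only [Pi.smul_apply, smul_eq_mul, RingHom.id_apply]; ring

/-- The sum of the values of a function at the two ends of an edge. -/
noncomputable def vertexSum : (Γ.Vertex → K) →ₗ[K] (Γ.Edge → K) where
  toFun g e := g (Γ.vertex (Γ.outDart e)) + g (Γ.vertex (Γ.flip (Γ.outDart e)))
  map_add' h h' := by ext e; simp only [Pi.add_apply]; ring
  map_smul' a h := by ext e; simp only [Pi.smul_apply, smul_eq_mul, RingHom.id_apply]; ring

theorem faceFlow_edge (h : Γ.Face → K) {d : D} (hd : Γ.out d = true) :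
    Γ.faceFlow h (Γ.edge d) = h (Γ.face (Γ.rot d)) - h (Γ.face d) := by
  simp only [faceFlow, LinearMap.coe_mk, AddHom.coe_mk, Γ.outDart_edge hd, face_flip]

theorem faceFlow_edge_of_in (h : Γ.Face → K) {d : D} (hd : Γ.out d = false) :
    Γ.faceFlow h (Γ.edge d) = h (Γ.face d) - h (Γ.face (Γ.rot d)) := by
  rw [← Γ.edge_flip d, Γ.faceFlow_edge h (by rw [Γ.out_flip, hd]; rfl), ← face_flip, Γ.flip_flip,
    ← face_flip]

theorem isFlow_faceFlow (h : Γ.Face → K) : Γ.IsFlow (Γ.faceFlow h) := by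
  intro d
  cases hd : Γ.out d with
  | true =>
    rw [Γ.faceFlow_edge h hd, Γ.faceFlow_edge h (by rw [Γ.out_rot, hd]),
      Γ.faceFlow_edge h (by rw [Γ.out_rot, Γ.out_rot, hd]), Γ.rot_rot_rot]
    ring
  | false =>
    rw [Γ.faceFlow_edge_of_in h hd, Γ.faceFlow_edge_of_in h (by rw [Γ.out_rot, hd]),
      Γ.faceFlow_edge_of_in h (by rw [Γ.out_rot, Γ.out_rot, hd]), Γ.rot_rot_rot]
    ring

theorem nonempty_dart (Γ : ConnectedWeb D) : Nonempty D := by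
  by_contra hD
  rw [not_nonempty_iff] at hD
  have := Γ.euler
  simp at this

/-- A potential with zero flow agrees across every edge, hence is constant by connectedness. -/
theorem finrank_ker_faceFlow_le : Module.finrank K (LinearMap.ker (Γ.faceFlow (K := K))) ≤ 1 := by
  obtain ⟨d₀⟩ := Γ.nonempty_dart
  have hc : ∀ h : Γ.Face → K, Γ.faceFlow h = 0 → ∀ x, h x = h (Γ.face d₀) := by
    intro h hh x
    have hrot : ∀ d, h (Γ.face (Γ.rot d)) = h (Γ.face d) := by
      intro d
      have := congrFun hh (Γ.edge d)
      cases hd : Γ.out d with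
      | true => rw [Γ.faceFlow_edge h hd] at this; exact sub_eq_zero.1 this
      | false => rw [Γ.faceFlow_edge_of_in h hd] at this; exact (sub_eq_zero.1 this).symm
    induction x using Quotient.inductionOn with | _ d => ?_
    exact Γ.eq_of_invariant (fun d => h (Γ.face d)) hrot (fun d => by rw [face_flip, hrot]) d d₀
  have h1 : (fun _ => 1 : Γ.Face → K) ∈ LinearMap.ker (Γ.faceFlow (K := K)) := by
    rw [LinearMap.mem_ker]; ext e; simp [faceFlow]
  refine finrank_le_one ⟨_, h1⟩ fun w => ⟨w.1 (Γ.face d₀), Subtype.ext (funext fun x => ?_)⟩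
  simpa using (hc w.1 w.2 x).symm

/-- The web is bipartite: multiplying by +1 at sources and -1 at sinks turns vanishing sums along
edges into equalities, and connectedness leaves one free constant. -/
theorem finrank_ker_vertexSum_le : Module.finrank K (LinearMap.ker (Γ.vertexSum (K := K))) ≤ 1 := by
  obtain ⟨d₀⟩ := Γ.nonempty_dart
  let σ : D → K := fun d => if Γ.out d = true then 1 else -1
  have hσflip : ∀ d, σ (Γ.flip d) = -σ d := by
    intro d; simp only [σ, Γ.out_flip]; cases Γ.out d <;> simp
  have hσrot : ∀ d, σ (Γ.rot d) = σ d := fun d => by simp only [σ, Γ.out_rot]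
  have hσσ : ∀ d, σ d * σ d = 1 := by intro d; simp only [σ]; split <;> simp
  have hc : ∀ g : Γ.Vertex → K, Γ.vertexSum g = 0 →
      ∀ d, σ d * g (Γ.vertex d) = σ d₀ * g (Γ.vertex d₀) := by
    intro g hg d
    refine Γ.eq_of_invariant (fun d => σ d * g (Γ.vertex d)) (fun d => by simp [hσrot])
      (fun d => ?_) d d₀
    have hout : ∀ d, Γ.out d = true → g (Γ.vertex d) + g (Γ.vertex (Γ.flip d)) = 0 := by
      intro d hd
      have := congrFun hg (Γ.edge d)
      simpa [vertexSum, Γ.outDart_edge hd] using this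
    have : g (Γ.vertex d) + g (Γ.vertex (Γ.flip d)) = 0 := by
      cases hd : Γ.out d with
      | true => exact hout d hd
      | false =>
        have := hout (Γ.flip d) (by rw [Γ.out_flip, hd]; rfl)
        rwa [Γ.flip_flip, add_comm] at this
    simp only [hσflip]
    linear_combination (-σ d) * this
  let s : Γ.Vertex → K := Quotient.lift σ fun a b hab =>
    Equiv.Perm.SameCycle.apply_eq hσrot hab
  have h1 : s ∈ LinearMap.ker (Γ.vertexSum (K := K)) := by
    rw [LinearMap.mem_ker]; ext e
    change σ _ + σ _ = 0
    rw [hσflip, add_neg_cancel]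
  refine finrank_le_one ⟨_, h1⟩ fun w =>
    ⟨σ d₀ * w.1 (Γ.vertex d₀), Subtype.ext (funext fun x => ?_)⟩
  induction x using Quotient.inductionOn with | _ d => ?_
  change σ d₀ * w.1 (Γ.vertex d₀) * σ d = w.1 (Γ.vertex d)
  rw [← hc w.1 w.2 d]
  linear_combination w.1 (Γ.vertex d) * hσσ d

open Classical in
-- Double counting over darts: grouped by edges, two darts each, they give the left side; grouped by
-- vertices, three darts each, they give the conservation laws.
theorem sum_vertexSum_mul_eq_zero [Fintype D] [Fintype Γ.Edge] {f : Γ.Edge → K} (hf : Γ.IsFlow f)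
    (g : Γ.Vertex → K) : ∑ e, Γ.vertexSum g e * f e = 0 := by
  have h1 : ∑ e, Γ.vertexSum g e * f e = ∑ d : D, g (Γ.vertex d) * f (Γ.edge d) := by
    rw [← Finset.sum_fiberwise Finset.univ Γ.edge]
    refine Finset.sum_congr rfl fun e _ => ?_
    have : Finset.univ.filter (fun d => Γ.edge d = e)
        = {Γ.outDart e, Γ.flip (Γ.outDart e)} := by
      ext d
      simp only [Finset.mem_filter, Finset.mem_univ, true_and, Finset.mem_insert,
        Finset.mem_singleton]
      rw [← Γ.edge_eq_iff, Γ.edge_outDart, eq_comm]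
    rw [this, Finset.sum_pair (Γ.flip_ne _).symm]
    simp only [edge_flip, edge_outDart, vertexSum, LinearMap.coe_mk, AddHom.coe_mk]
    ring
  rw [h1, ← Finset.sum_fiberwise Finset.univ Γ.vertex]
  refine Finset.sum_eq_zero fun v _ => ?_
  induction v using Quotient.inductionOn with | _ d => ?_
  have : Finset.univ.filter (fun x => Γ.vertex x = Γ.vertex d)
      = {d, Γ.rot d, Γ.rot (Γ.rot d)} := by
    ext x
    simp only [Finset.mem_filter, Finset.mem_univ, true_and, Finset.mem_insert,
      Finset.mem_singleton]
    rw [← Γ.vertex_eq_iff, eq_comm]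
  refine (Finset.sum_congr this fun _ _ => rfl).trans ?_
  rw [Finset.sum_insert, Finset.sum_pair (Γ.rot_ne _).symm]
  · simp only [vertex_rot]
    linear_combination g (Γ.vertex d) * hf d
  · simp only [Finset.mem_insert, Finset.mem_singleton, not_or]
    exact ⟨(Γ.rot_ne d).symm, (Γ.rot_rot_ne d).symm⟩

/-- The first cohomology of the sphere vanishes: a flow comes from a function on the faces. -/
theorem IsFlow.exists_faceFlow_eq [Finite D] {f : Γ.Edge → K} (hf : Γ.IsFlow f) :
    ∃ h : Γ.Face → K, Γ.faceFlow h = f := by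
  classical
  have := Fintype.ofFinite D
  have := Fintype.ofFinite Γ.Edge
  have := Fintype.ofFinite Γ.Vertex
  have := Fintype.ofFinite Γ.Face
  let A : Matrix Γ.Edge Γ.Vertex K := LinearMap.toMatrix' (Γ.vertexSum (K := K))
  have hA : ∀ f : Γ.Edge → K, Γ.IsFlow f → f ∈ LinearMap.ker A.transpose.mulVecLin := by
    intro f hf
    rw [LinearMap.mem_ker]
    ext v
    have := Γ.sum_vertexSum_mul_eq_zero hf (Pi.single v 1)
    rw [Matrix.mulVecLin_apply, Pi.zero_apply, ← this]
    simp only [Matrix.mulVec, dotProduct, Matrix.transpose_apply, A, LinearMap.toMatrix'_apply]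
  have hle : LinearMap.range (Γ.faceFlow (K := K)) ≤ LinearMap.ker A.transpose.mulVecLin := by
    rintro _ ⟨h, rfl⟩
    exact hA _ (Γ.isFlow_faceFlow h)
  -- The transpose has the rank of `vertexSum`, at least V - 1, so its kernel has dimension at most
  -- E - V + 1 = F - 1 by Euler's formula, which is at most the rank of `faceFlow`.
  have hrank : Module.finrank K (LinearMap.ker A.transpose.mulVecLin)
      ≤ Module.finrank K (LinearMap.range (Γ.faceFlow (K := K))) := by
    have e1 := LinearMap.finrank_range_add_finrank_ker A.transpose.mulVecLin
    have e2 := LinearMap.finrank_range_add_finrank_ker (Γ.faceFlow (K := K))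
    have e3 := LinearMap.finrank_range_add_finrank_ker (Γ.vertexSum (K := K))
    have e4 : Module.finrank K (LinearMap.range A.transpose.mulVecLin)
        = Module.finrank K (LinearMap.range (Γ.vertexSum (K := K))) := by
      change A.transpose.rank = _
      rw [Matrix.rank_transpose, Matrix.rank, ← Matrix.toLin'_apply', Matrix.toLin'_toMatrix']
    have e5 := Γ.finrank_ker_faceFlow_le (K := K)
    have e6 := Γ.finrank_ker_vertexSum_le (K := K)
    have e7 := Γ.euler
    simp only [Module.finrank_pi] at e1 e2 e3
    change Nat.card Γ.Vertex + Nat.card Γ.Face = Nat.card Γ.Edge + 2 at e7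
    simp only [Nat.card_eq_fintype_card] at e7
    omega
  have heq := Submodule.eq_of_le_of_finrank_le hle hrank
  exact (heq ▸ hA f hf : f ∈ LinearMap.range (Γ.faceFlow (K := K)))

end Cohomology

/-- The faces of a web have a proper colouring with three colours. -/
theorem exists_face_colouring [Finite D] : ∃ h : Γ.Face → ZMod 3,
    (∀ d, Γ.out d = true → h (Γ.face (Γ.rot d)) = h (Γ.face d) + 1) ∧
    (∀ d, Γ.out d = false → h (Γ.face (Γ.rot d)) = h (Γ.face d) - 1) := by
  have h3 : (1 + 1 + 1 : ZMod 3) = 0 := by decide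
  have : Fact (Nat.Prime 3) := ⟨Nat.prime_three⟩
  -- Trivalence makes the constant 1 a flow modulo 3; its potential is the colouring.
  have hf : Γ.IsFlow (fun _ => 1 : Γ.Edge → ZMod 3) := fun _ => h3
  obtain ⟨h, hh⟩ := hf.exists_faceFlow_eq
  refine ⟨h, fun d hd => ?_, fun d hd => ?_⟩
  · have := congrFun hh (Γ.edge d)
    rw [Γ.faceFlow_edge h hd] at this
    linear_combination this
  · have := congrFun hh (Γ.edge d)
    rw [Γ.faceFlow_edge_of_in h hd] at this
    linear_combination -this

end ConnectedWeb

/-! ### The faces around a square and the Jordan curve property. -/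

namespace ConnectedWeb

variable {D : Type*} (Γ : ConnectedWeb D)

/-- The web has no bridge: the potential modulo 3 changes by 1 or -1 across each edge. -/
theorem face_rot_ne [Finite D] (d : D) : Γ.face (Γ.rot d) ≠ Γ.face d := by
  obtain ⟨h, h1, h2⟩ := Γ.exists_face_colouring
  intro hd
  cases ho : Γ.out d with
  | true =>
    have := h1 d ho
    rw [hd] at this
    exact absurd this (by generalize h _ = a; revert a; decide)
  | false =>
    have := h2 d ho
    rw [hd] at this
    exact absurd this (by generalize h _ = a; revert a; decide)

section DartFlow

/-- The sign of a dart: positive if it points along the orientation of its edge. -/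
def sign (d : D) : ℚ := if Γ.out d = true then 1 else -1

theorem sign_ne_zero (d : D) : Γ.sign d ≠ 0 := by
  unfold sign; split <;> norm_num

theorem sign_flip (d : D) : Γ.sign (Γ.flip d) = -Γ.sign d := by
  unfold sign; rw [Γ.out_flip]; cases Γ.out d <;> simp

theorem sign_rot (d : D) : Γ.sign (Γ.rot d) = Γ.sign d := by
  unfold sign; rw [Γ.out_rot]

open Classical in
/-- The unit flow along a dart. -/
noncomputable def dartFlow (y : D) : Γ.Edge → ℚ :=
  fun e => if e = Γ.edge y then Γ.sign y else 0

open Classical in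
/-- The boundary of a dart at its own vertex, as a function of a dart at the test vertex. -/
noncomputable def dartBoundary (d y : D) : ℚ :=
  if Γ.vertex d = Γ.vertex y then Γ.sign y else 0

theorem dartBoundary_rot (d y : D) : Γ.dartBoundary d (Γ.rot y) = Γ.dartBoundary d y := by
  rw [dartBoundary, dartBoundary, Γ.vertex_rot, Γ.sign_rot]

open Classical in
theorem sum_vertex_indicator (d y : D) :
    (if d = y then 1 else 0) + (if Γ.rot d = y then 1 else 0)
      + (if Γ.rot (Γ.rot d) = y then 1 else 0)
      = if Γ.vertex d = Γ.vertex y then (1 : ℚ) else 0 := by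
  have h1 := Γ.rot_ne d
  have h2 := Γ.rot_ne (Γ.rot d)
  have h3 := Γ.rot_rot_ne d
  simp only [Γ.vertex_eq_iff]
  split_ifs <;> grind

/-- The divergence of a unit flow is concentrated at the two ends of its edge. As `dartBoundary`
depends only on the vertex of the dart, these terms telescope along a path and cancel for a closed
one. -/
theorem dartFlow_vertex (d y : D) :
    Γ.dartFlow y (Γ.edge d) + Γ.dartFlow y (Γ.edge (Γ.rot d))
      + Γ.dartFlow y (Γ.edge (Γ.rot (Γ.rot d)))
      = Γ.dartBoundary d y - Γ.dartBoundary d (Γ.flip y) := by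
  classical
  have key : ∀ x, Γ.dartFlow y (Γ.edge x)
      = Γ.sign y * ((if x = y then 1 else 0) + (if x = Γ.flip y then 1 else 0)) := by
    intro x
    have := Γ.flip_ne y
    by_cases h1 : x = y
    · subst h1
      simp [dartFlow, this.symm]
    · by_cases h2 : x = Γ.flip y
      · subst h2
        simp [dartFlow, this]
      · rw [dartFlow, if_neg]
        · simp [h1, h2]
        · rw [eq_comm, Γ.edge_eq_iff]
          tauto
  have h1 := Γ.sum_vertex_indicator d y
  have h2 := Γ.sum_vertex_indicator d (Γ.flip y)
  have e1 : Γ.dartBoundary d y = Γ.sign y * if Γ.vertex d = Γ.vertex y then (1 : ℚ) else 0 := by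
    rw [dartBoundary]; split_ifs <;> simp
  have e2 : Γ.dartBoundary d (Γ.flip y)
      = -Γ.sign y * if Γ.vertex d = Γ.vertex (Γ.flip y) then (1 : ℚ) else 0 := by
    rw [dartBoundary, Γ.sign_flip]; split_ifs <;> simp
  rw [key, key, key, e1, e2, ← h1, ← h2]
  ring

end DartFlow

variable {Γ}

namespace Square

variable (S : Γ.Square)

/-- The sides of the square, as darts running along its boundary. -/
def side (i : ℕ) : D := (Γ.next ^ i) S.base

/-- The face on the other side of a side of the square. -/
def nbr (i : ℕ) : Γ.Face := Γ.face (Γ.flip (S.side i))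

theorem side_succ (i : ℕ) : S.side (i + 1) = Γ.rot (Γ.flip (S.side i)) := by
  rw [side, pow_succ', Equiv.Perm.mul_apply]; rfl

theorem side_four : S.side 4 = S.side 0 := by
  have := Function.iterate_minimalPeriod (f := Γ.next) (x := S.base)
  rw [S.four_sides] at this
  rw [Equiv.Perm.iterate_eq_pow] at this
  exact this

theorem side_ne {i j : ℕ} (hi : i < 4) (hj : j < 4) (h : i ≠ j) : S.side i ≠ S.side j := by
  intro hij
  apply h
  have := Function.iterate_eq_iterate_iff_of_lt_minimalPeriod (f := Γ.next) (x := S.base)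
    (m := i) (n := j) (by rwa [S.four_sides]) (by rwa [S.four_sides])
  rw [Equiv.Perm.iterate_eq_pow, Equiv.Perm.iterate_eq_pow] at this
  exact this.1 hij

theorem face_side (i : ℕ) : Γ.face (S.side i) = Γ.face S.base := by
  induction i with
  | zero => rfl
  | succ i ih => rw [side_succ, ← ih]; exact Γ.face_next _

theorem out_side_succ (i : ℕ) : Γ.out (S.side (i + 1)) = !Γ.out (S.side i) := by
  rw [side_succ, Γ.out_rot, Γ.out_flip]

theorem nbr_eq (i : ℕ) : S.nbr i = Γ.face (Γ.rot (S.side i)) := Γ.face_flip _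

theorem rot_rot_side_succ (i : ℕ) : Γ.rot (Γ.rot (S.side (i + 1))) = Γ.flip (S.side i) := by
  rw [side_succ, Γ.rot_rot_rot]

theorem face_rot_rot_side_succ (i : ℕ) : Γ.face (Γ.rot (Γ.rot (S.side (i + 1)))) = S.nbr i := by
  rw [rot_rot_side_succ, nbr]

theorem face_flip_rot_side_succ (i : ℕ) :
    Γ.face (Γ.flip (Γ.rot (S.side (i + 1)))) = S.nbr i := by
  rw [face_flip, face_rot_rot_side_succ]

theorem face_flip_rot_side_zero : Γ.face (Γ.flip (Γ.rot (S.side 0))) = S.nbr 3 := by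
  rw [← S.side_four, face_flip_rot_side_succ]

theorem dartFlow_side_eq_zero {y : D} {i : ℕ} (h1 : y ≠ S.side i)
    (h2 : Γ.face y ≠ S.nbr i) : Γ.dartFlow y (Γ.edge (S.side i)) = 0 := by
  rw [dartFlow, if_neg]
  rw [Γ.edge_eq_iff]
  rintro (rfl | rfl)
  · exact h1 rfl
  · exact h2 rfl

theorem face_diagonal (i : Fin 4) : Γ.face (S.diagonal i) = S.nbr i := (S.nbr_eq i).symm

section Finite

variable [Finite D]

theorem nbr_ne_base (i : ℕ) : S.nbr i ≠ Γ.face S.base := by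
  rw [nbr_eq, ← S.face_side i]; exact Γ.face_rot_ne _

theorem nbr_ne_succ (i : ℕ) : S.nbr i ≠ S.nbr (i + 1) := by
  rw [← S.face_rot_rot_side_succ i, nbr_eq]; exact Γ.face_rot_ne _

theorem nbr_three_ne_zero : S.nbr 3 ≠ S.nbr 0 := by
  have := S.nbr_ne_succ 3
  rwa [nbr, nbr, S.side_four, ← nbr, ← nbr] at this

/-- Jordan curve property: if one pair of opposite neighbours of the square coincides, the other
one does not. -/
theorem nbr_ne_of_nbr_eq (h02 : S.nbr 0 = S.nbr 2) : S.nbr 1 ≠ S.nbr 3 := by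
  intro h13
  obtain ⟨m, hm⟩ := Equiv.Perm.SameCycle.exists_nat_pow_eq
    (Quotient.exact h02 : Γ.next.SameCycle (Γ.flip (S.side 0)) (Γ.flip (S.side 2)))
  let w : ℕ → D := fun j => (Γ.next ^ j) (Γ.flip (S.side 0))
  have hw : ∀ j, w (j + 1) = Γ.rot (Γ.flip (w j)) := fun j => by
    simp only [w, pow_succ', Equiv.Perm.mul_apply]; rfl
  have hface : ∀ j, Γ.face (w j) = S.nbr 0 := by
    intro j
    induction j with
    | zero => rfl
    | succ j ih => rw [hw, ← ih]; exact Γ.face_next _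
  -- The walk `w` follows the common face of neighbours 0 and 2 from the end of side 0 to the start
  -- of side 3; sides 3 and 0 close it up. The resulting cycle runs once along side 3 and avoids
  -- side 1, so its potential jumps from the square to neighbour 3 but not to neighbour 1.
  let f : Γ.Edge → ℚ := fun e => ∑ j ∈ Finset.range m, Γ.dartFlow (w j) e
    + (Γ.dartFlow (S.side 3) e + Γ.dartFlow (S.side 0) e)
  have hf : Γ.IsFlow f := by
    intro d
    have h1 : ∑ j ∈ Finset.range m, Γ.dartFlow (w j) (Γ.edge d)
        + ∑ j ∈ Finset.range m, Γ.dartFlow (w j) (Γ.edge (Γ.rot d))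
        + ∑ j ∈ Finset.range m, Γ.dartFlow (w j) (Γ.edge (Γ.rot (Γ.rot d)))
        = Γ.dartBoundary d (w 0) - Γ.dartBoundary d (w m) := by
      rw [← Finset.sum_add_distrib, ← Finset.sum_add_distrib,
        ← Finset.sum_range_sub' (fun j => Γ.dartBoundary d (w j))]
      refine Finset.sum_congr rfl fun j _ => ?_
      rw [Γ.dartFlow_vertex, hw, Γ.dartBoundary_rot]
    have h2 := Γ.dartFlow_vertex d (S.side 3)
    have h3 := Γ.dartFlow_vertex d (S.side 0)
    have e1 : Γ.dartBoundary d (Γ.flip (S.side 3)) = Γ.dartBoundary d (S.side 0) := by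
      rw [← Γ.dartBoundary_rot, ← side_succ, side_four]
    have e2 : Γ.dartBoundary d (w m) = Γ.dartBoundary d (S.side 3) := by
      rw [S.side_succ 2, Γ.dartBoundary_rot, ← hm]
    have e3 : Γ.dartBoundary d (w 0) = Γ.dartBoundary d (Γ.flip (S.side 0)) := rfl
    simp only [f]
    linear_combination h1 + h2 + h3 - e1 - e2 + e3
  obtain ⟨h, hh⟩ := hf.exists_faceFlow_eq
  have hside : ∀ i, f (Γ.edge (S.side i)) = Γ.sign (S.side i) * (h (S.nbr i) - h (Γ.face S.base)) := by
    intro i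
    rw [← hh, sign]
    cases ho : Γ.out (S.side i) with
    | true => rw [Γ.faceFlow_edge h ho, ← nbr_eq, face_side]; simp
    | false => rw [Γ.faceFlow_edge_of_in h ho, ← nbr_eq, face_side]; simp
  have hf1 : f (Γ.edge (S.side 1)) = 0 := by
    simp only [f]
    rw [Finset.sum_eq_zero, S.dartFlow_side_eq_zero, S.dartFlow_side_eq_zero]
    · norm_num
    · exact S.side_ne (by norm_num) (by norm_num) (by norm_num)
    · rw [face_side]; exact (S.nbr_ne_base 1).symm
    · exact S.side_ne (by norm_num) (by norm_num) (by norm_num)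
    · rw [face_side]; exact (S.nbr_ne_base 1).symm
    · intro j _
      refine S.dartFlow_side_eq_zero (fun hj => ?_) ?_
      · have := hface j
        rw [hj, face_side] at this
        exact S.nbr_ne_base 0 this.symm
      · rw [hface]; exact S.nbr_ne_succ 0
  have hf3 : f (Γ.edge (S.side 3)) = Γ.sign (S.side 3) := by
    simp only [f]
    rw [Finset.sum_eq_zero, S.dartFlow_side_eq_zero (y := S.side 0)]
    · simp [dartFlow]
    · exact S.side_ne (by norm_num) (by norm_num) (by norm_num)
    · rw [face_side]; exact (S.nbr_ne_base 3).symm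
    · intro j _
      refine S.dartFlow_side_eq_zero (fun hj => ?_) ?_
      · have := hface j
        rw [hj, face_side] at this
        exact S.nbr_ne_base 0 this.symm
      · rw [hface]; exact S.nbr_three_ne_zero.symm
  rw [hside] at hf1 hf3
  have h4 := (mul_eq_zero.1 hf1).resolve_left (Γ.sign_ne_zero _)
  rw [h13] at h4
  rw [h4, mul_zero] at hf3
  exact Γ.sign_ne_zero _ hf3.symm

/-- The diagonal at a corner separates the two neighbours that meet there, and consecutive
neighbours differ. Two of these four pairs of faces can therefore agree only if some pair of
opposite neighbours coincides. -/
theorem isSeparating_iff : S.IsSeparating ↔ S.nbr 0 = S.nbr 2 ∨ S.nbr 1 = S.nbr 3 := by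
  have h01 := S.nbr_ne_succ 0
  have h12 := S.nbr_ne_succ 1
  have h23 := S.nbr_ne_succ 2
  have h30 := S.nbr_three_ne_zero
  have f0 : Γ.face (Γ.flip (S.diagonal 0)) = S.nbr 3 := S.face_flip_rot_side_zero
  have f1 : Γ.face (Γ.flip (S.diagonal 1)) = S.nbr 0 := S.face_flip_rot_side_succ 0
  have f2 : Γ.face (Γ.flip (S.diagonal 2)) = S.nbr 1 := S.face_flip_rot_side_succ 1
  have f3 : Γ.face (Γ.flip (S.diagonal 3)) = S.nbr 2 := S.face_flip_rot_side_succ 2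
  have g0 : Γ.face (S.diagonal 0) = S.nbr 0 := S.face_diagonal 0
  have g1 : Γ.face (S.diagonal 1) = S.nbr 1 := S.face_diagonal 1
  have g2 : Γ.face (S.diagonal 2) = S.nbr 2 := S.face_diagonal 2
  have g3 : Γ.face (S.diagonal 3) = S.nbr 3 := S.face_diagonal 3
  constructor
  · rintro ⟨i, j, hij, h⟩
    unfold IsIsthmus at h
    rw [Sym2.eq_iff] at h
    fin_cases i <;> fin_cases j <;>
      simp only [Fin.zero_eta, Fin.mk_one, Fin.reduceFinMk, f0, f1, f2, f3, g0, g1, g2, g3] at h hij <;>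
      grind
  · rintro (h | h)
    · refine ⟨0, 3, by decide, ?_⟩
      rw [IsIsthmus, f0, f3, g0, g3, h, Sym2.eq_swap]
    · refine ⟨0, 1, by decide, ?_⟩
      rw [IsIsthmus, f0, f1, g0, g1, h, Sym2.eq_swap]

end Finite

end Square

end ConnectedWeb

/-! ### Reflections in lines and orthogonality in ℂ³. -/

section LineProj

open Matrix
open scoped ComplexOrder

/-- The matrix of the orthogonal projection onto the line spanned by a vector. -/
noncomputable def lineProj (v : Fin 3 → ℂ) : Matrix (Fin 3) (Fin 3) ℂ :=
  (star v ⬝ᵥ v)⁻¹ • vecMulVec v (star v)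

theorem star_dotProduct_self_ne_zero {v : Fin 3 → ℂ} (hv : v ≠ 0) : star v ⬝ᵥ v ≠ 0 :=
  fun h => hv (dotProduct_star_self_eq_zero.1 h)

theorem star_dotProduct_swap (v w : Fin 3 → ℂ) : star w ⬝ᵥ v = star (star v ⬝ᵥ w) := by
  rw [star_dotProduct]

theorem lineProj_mulVec (v x : Fin 3 → ℂ) :
    lineProj v *ᵥ x = ((star v ⬝ᵥ v)⁻¹ * (star v ⬝ᵥ x)) • v := by
  rw [lineProj, smul_mulVec, vecMulVec_mulVec, op_smul_eq_smul, smul_smul]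

theorem lineProj_mulVec_self {v : Fin 3 → ℂ} (hv : v ≠ 0) : lineProj v *ᵥ v = v := by
  rw [lineProj_mulVec, inv_mul_cancel₀ (star_dotProduct_self_ne_zero hv), one_smul]

theorem conjTranspose_lineProj (v : Fin 3 → ℂ) : (lineProj v)ᴴ = lineProj v := by
  rw [lineProj, conjTranspose_smul, conjTranspose_vecMulVec, star_star, star_inv₀,
    ← star_dotProduct_swap]

theorem trace_lineProj {v : Fin 3 → ℂ} (hv : v ≠ 0) : (lineProj v).trace = 1 := by
  rw [lineProj, trace_smul, trace_vecMulVec, dotProduct_comm v, smul_eq_mul,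
    inv_mul_cancel₀ (star_dotProduct_self_ne_zero hv)]

theorem lineProj_mul (v w : Fin 3 → ℂ) : lineProj v * lineProj w
    = ((star v ⬝ᵥ v)⁻¹ * (star w ⬝ᵥ w)⁻¹ * (star v ⬝ᵥ w)) • vecMulVec v (star w) := by
  rw [lineProj, lineProj, smul_mul_smul_comm, vecMulVec_mul_vecMulVec, vecMulVec_smul, smul_smul]

theorem lineProj_mul_self {v : Fin 3 → ℂ} (hv : v ≠ 0) : lineProj v * lineProj v = lineProj v := by
  rw [lineProj_mul, inv_mul_cancel_right₀ (star_dotProduct_self_ne_zero hv), lineProj]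

theorem lineProj_mul_eq_zero {v w : Fin 3 → ℂ} (h : star v ⬝ᵥ w = 0) :
    lineProj v * lineProj w = 0 := by
  rw [lineProj_mul, h, mul_zero, zero_smul]

/-- The trace is |⟨v, w⟩|² / (|v|² |w|²). -/
theorem orthogonal_of_trace_lineProj_mul {v w : Fin 3 → ℂ} (hv : v ≠ 0) (hw : w ≠ 0)
    (h : (lineProj v * lineProj w).trace = 0) : star v ⬝ᵥ w = 0 := by
  rw [lineProj_mul, trace_smul, trace_vecMulVec, smul_eq_mul, dotProduct_comm v,
    star_dotProduct_swap v w] at h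
  simpa [star_dotProduct_self_ne_zero hv, star_dotProduct_self_ne_zero hw] using h

theorem mk_eq_mk_of_lineProj_eq {v w : Fin 3 → ℂ} (hv : v ≠ 0) (hw : w ≠ 0)
    (h : lineProj v = lineProj w) :
    Projectivization.mk ℂ v hv = Projectivization.mk ℂ w hw := by
  have := lineProj_mulVec_self hw
  rw [← h, lineProj_mulVec] at this
  rw [eq_comm, Projectivization.mk_eq_mk_iff']
  exact ⟨_, this⟩

theorem lineProj_rep_injective : Function.Injective fun l : CP2 => lineProj l.rep := by
  intro l l' h
  rw [← l.mk_rep, ← l'.mk_rep]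
  exact mk_eq_mk_of_lineProj_eq _ _ h

/-- An orthogonal basis of lines gives a decomposition of the identity. -/
theorem lineProj_add_lineProj_add_lineProj {a b c : Fin 3 → ℂ} (ha : a ≠ 0) (hb : b ≠ 0)
    (hc : c ≠ 0) (hab : star a ⬝ᵥ b = 0) (hbc : star b ⬝ᵥ c = 0) (hca : star c ⬝ᵥ a = 0) :
    lineProj a + lineProj b + lineProj c = 1 := by
  have hba : star b ⬝ᵥ a = 0 := by rw [star_dotProduct_swap, hab, star_zero]
  have hcb : star c ⬝ᵥ b = 0 := by rw [star_dotProduct_swap, hbc, star_zero]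
  have hac : star a ⬝ᵥ c = 0 := by rw [star_dotProduct_swap, hca, star_zero]
  have na := star_dotProduct_self_ne_zero ha
  have nb := star_dotProduct_self_ne_zero hb
  have nc := star_dotProduct_self_ne_zero hc
  -- `L` is a left inverse of the matrix `U` with columns a, b, c. For square matrices it is also a
  -- right inverse, and `U * L` expands to the sum of the projections.
  let L : Matrix (Fin 3) (Fin 3) ℂ :=
    of ![(star a ⬝ᵥ a)⁻¹ • star a, (star b ⬝ᵥ b)⁻¹ • star b, (star c ⬝ᵥ c)⁻¹ • star c]
  let U : Matrix (Fin 3) (Fin 3) ℂ := (of ![a, b, c])ᵀ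
  have hLU : L * U = 1 := by
    ext i j
    change (![(star a ⬝ᵥ a)⁻¹ • star a, (star b ⬝ᵥ b)⁻¹ • star b, (star c ⬝ᵥ c)⁻¹ • star c] i)
      ⬝ᵥ (![a, b, c] j) = _
    fin_cases i <;> fin_cases j <;> simp [*]
  have hUL := mul_eq_one_comm.1 hLU
  rw [← hUL]
  ext i j
  simp [L, U, lineProj, mul_apply, Fin.sum_univ_three, vecMulVec_apply]
  ring

theorem star_two_smul_lineProj_sub_one (v : Fin 3 → ℂ) :
    star ((2 : ℂ) • lineProj v - 1) = (2 : ℂ) • lineProj v - 1 := by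
  rw [star_eq_conjTranspose, conjTranspose_sub, conjTranspose_smul, conjTranspose_lineProj]
  simp

theorem two_smul_lineProj_sub_one_mul_self {v : Fin 3 → ℂ} (hv : v ≠ 0) :
    ((2 : ℂ) • lineProj v - 1) * ((2 : ℂ) • lineProj v - 1) = 1 := by
  rw [sub_mul, mul_sub, smul_mul_smul_comm, lineProj_mul_self hv, mul_one, one_mul]
  module

theorem two_smul_lineProj_sub_one_mem {v : Fin 3 → ℂ} (hv : v ≠ 0) :
    (2 : ℂ) • lineProj v - 1 ∈ specialUnitaryGroup (Fin 3) ℂ := by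
  rw [mem_specialUnitaryGroup_iff, mem_unitaryGroup_iff, star_two_smul_lineProj_sub_one]
  refine ⟨two_smul_lineProj_sub_one_mul_self hv, ?_⟩
  have h : ∀ (k : ℂ) (w : Fin 3 → ℂ), (k • vecMulVec v w - 1).det = k * (w ⬝ᵥ v) - 1 := by
    intro k w
    simp [det_fin_three, vecMulVec_apply, dotProduct, Fin.sum_univ_three, one_apply]
    ring
  rw [lineProj, smul_smul, h, mul_assoc, inv_mul_cancel₀ (star_dotProduct_self_ne_zero hv)]
  norm_num

/-- The reflection of determinant one fixing a nonzero vector. -/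
noncomputable def lineReflection (v : Fin 3 → ℂ) (hv : v ≠ 0) : SU3 :=
  ⟨(2 : ℂ) • lineProj v - 1, two_smul_lineProj_sub_one_mem hv⟩

theorem trace_two_smul_lineProj_sub_one {v : Fin 3 → ℂ} (hv : v ≠ 0) :
    ((2 : ℂ) • lineProj v - 1).trace = -1 := by
  rw [trace_sub, trace_smul, trace_lineProj hv, trace_one]
  norm_num

theorem eigenspace_two_smul_lineProj_sub_one {v : Fin 3 → ℂ} (hv : v ≠ 0) :
    Module.End.eigenspace (toLin' ((2 : ℂ) • lineProj v - 1)) 1 = ℂ ∙ v := by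
  ext x
  rw [Module.End.mem_eigenspace_iff, toLin'_apply, sub_mulVec, one_mulVec, one_smul,
    smul_mulVec, Submodule.mem_span_singleton]
  constructor
  · intro h
    refine ⟨(star v ⬝ᵥ v)⁻¹ * (star v ⬝ᵥ x), ?_⟩
    rw [← lineProj_mulVec]
    have h2 : (2 : ℂ) • lineProj v *ᵥ x = (2 : ℂ) • x := by
      rw [two_smul ℂ x]; exact eq_add_of_sub_eq h
    exact smul_right_injective _ two_ne_zero h2
  · rintro ⟨a, rfl⟩
    rw [mulVec_smul, lineProj_mulVec_self hv]
    module

/-- A matrix in `SU(3)` of trace `-1` is the reflection in the line it fixes. -/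
theorem eq_two_smul_lineProj_sub_one {M : Matrix (Fin 3) (Fin 3) ℂ}
    (hM : M ∈ specialUnitaryGroup (Fin 3) ℂ) (ht : M.trace = -1) {v : Fin 3 → ℂ} (hv : v ≠ 0)
    (he : Module.End.eigenspace (toLin' M) 1 = ℂ ∙ v) : M = (2 : ℂ) • lineProj v - 1 := by
  obtain ⟨hU, hdet⟩ := mem_specialUnitaryGroup_iff.1 hM
  have hMs : M * Mᴴ = 1 := mem_unitaryGroup_iff.1 hU
  have hsM : Mᴴ * M = 1 := mem_unitaryGroup_iff'.1 hU
  have hadj : M.adjugate = Mᴴ := by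
    have h := adjugate_mul M
    rw [hdet, one_smul] at h
    calc M.adjugate = M.adjugate * (M * Mᴴ) := by rw [hMs, mul_one]
      _ = Mᴴ := by rw [← mul_assoc, h, one_mul]
  -- Cayley–Hamilton in size 3. With adj M = Mᴴ and trace -1 it reads Mᴴ = M² + M - 1, so (M - 1)(M
  -- + 1)² = 0.
  have hCH : M.adjugate = M * M - M.trace • M + M.adjugate.trace • 1 := by
    ext i j
    fin_cases i <;> fin_cases j <;>
      simp [adjugate_fin_three, mul_apply, trace, Fin.sum_univ_three] <;> ring
  rw [hadj, trace_conjTranspose, ht, star_neg, star_one] at hCH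
  have hN : Mᴴ = M * M + M - 1 := by rw [hCH]; module
  have h3 : M * M * M + M * M - M = 1 := by
    rw [← hsM, hN]; noncomm_ring
  -- Unitarity removes the repeated factor: a matrix N with NᴴN = 0 vanishes, so M is an involution.
  have hNN : (M * M - 1)ᴴ * (M * M - 1) = 0 := by
    rw [conjTranspose_sub, conjTranspose_mul, conjTranspose_one]
    have e : Mᴴ * Mᴴ = M + 1 - Mᴴ := by
      nth_rewrite 2 [hN]
      rw [mul_sub, mul_add, ← mul_assoc, hsM, one_mul, mul_one]
    rw [e, hN]
    have : (M + 1 - (M * M + M - 1) - 1) * (M * M - 1)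
        = (M * M * M + M * M - M - 1) - (M * M * M + M * M - M - 1) * M := by noncomm_ring
    rw [this, h3]
    simp
  have hM2 : M * M = 1 := sub_eq_zero.1 (conjTranspose_mul_self_eq_zero.1 hNN)
  have hMH : Mᴴ = M := by rw [hN, hM2]; abel
  have hMv : M *ᵥ v = v := by
    have : v ∈ Module.End.eigenspace (toLin' M) 1 := he ▸ Submodule.mem_span_singleton_self v
    simpa [Module.End.mem_eigenspace_iff] using this
  -- Since M² = 1, the columns of M + 1 are fixed by M and thus lie on the given line. Taking
  -- adjoints and using MP = P gives M + 1 = 2P.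
  have hQP : lineProj v * (M + 1) = M + 1 := by
    apply ext_of_mulVec_single
    intro i
    have hx : (M + 1) *ᵥ Pi.single i 1 ∈ Module.End.eigenspace (toLin' M) 1 := by
      rw [Module.End.mem_eigenspace_iff, toLin'_apply, mulVec_mulVec, mul_add, hM2, mul_one,
        one_smul, add_comm]
    rw [he, Submodule.mem_span_singleton] at hx
    obtain ⟨a, ha⟩ := hx
    rw [← mulVec_mulVec, ← ha, mulVec_smul, lineProj_mulVec_self hv]
  have hPQ : (M + 1) * lineProj v = M + 1 := by
    have := congrArg conjTranspose hQP
    rwa [conjTranspose_mul, conjTranspose_add, hMH, conjTranspose_one,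
      conjTranspose_lineProj] at this
  have hMQ : M * lineProj v = lineProj v := by
    rw [lineProj, mul_smul_comm, mul_vecMulVec, hMv]
  rw [add_mul, hMQ, one_mul] at hPQ
  rw [two_smul, hPQ, add_sub_cancel_right]

/-- If the product of the reflections in three lines is the identity, the lines are orthogonal. -/
theorem orthogonal_of_reflections_mul_eq_one {a b c : Fin 3 → ℂ} (ha : a ≠ 0) (hb : b ≠ 0)
    (hc : c ≠ 0) (h : ((2 : ℂ) • lineProj a - 1) * ((2 : ℂ) • lineProj b - 1)
      * ((2 : ℂ) • lineProj c - 1) = 1) :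
    star a ⬝ᵥ b = 0 ∧ lineProj a + lineProj b + lineProj c = 1 := by
  have h1 : ((2 : ℂ) • lineProj a - 1) * ((2 : ℂ) • lineProj b - 1)
      = (2 : ℂ) • lineProj c - 1 := by
    have := congrArg (· * ((2 : ℂ) • lineProj c - 1)) h
    simpa only [mul_assoc, two_smul_lineProj_sub_one_mul_self hc, mul_one, one_mul] using this
  have h2 : (2 : ℂ) • (lineProj a * lineProj b) + 1 = lineProj a + lineProj b + lineProj c := by
    rw [sub_mul, mul_sub, smul_mul_smul_comm, mul_one, one_mul] at h1
    refine smul_right_injective _ (two_ne_zero (α := ℂ)) ?_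
    rw [← sub_eq_zero] at h1 ⊢
    rw [← h1]
    module
  -- In `h2` both sides have trace 3 up to the term in the product, whose trace is therefore 0.
  have h3 : star a ⬝ᵥ b = 0 := by
    apply orthogonal_of_trace_lineProj_mul ha hb
    have := congrArg trace h2
    rw [trace_add, trace_add, trace_add, trace_lineProj ha, trace_lineProj hb, trace_lineProj hc,
      trace_smul, trace_one] at this
    simp only [Fintype.card_fin, smul_eq_mul] at this
    linear_combination this / 2
  refine ⟨h3, ?_⟩
  rw [← h2, lineProj_mul_eq_zero h3, smul_zero, zero_add]

/-- The reflections in three orthogonal lines have product the identity. -/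
theorem reflections_mul_eq_one {a b c : Fin 3 → ℂ} (ha : a ≠ 0) (hb : b ≠ 0) (hc : c ≠ 0)
    (hab : star a ⬝ᵥ b = 0) (hbc : star b ⬝ᵥ c = 0) (hca : star c ⬝ᵥ a = 0) :
    ((2 : ℂ) • lineProj a - 1) * ((2 : ℂ) • lineProj b - 1)
      * ((2 : ℂ) • lineProj c - 1) = 1 := by
  have h := lineProj_add_lineProj_add_lineProj ha hb hc hab hbc hca
  have h1 : ((2 : ℂ) • lineProj a - 1) * ((2 : ℂ) • lineProj b - 1)
      = (2 : ℂ) • lineProj c - 1 := by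
    rw [sub_mul, mul_sub, smul_mul_smul_comm, lineProj_mul_eq_zero hab, mul_one, one_mul,
      ← h, smul_zero]
    module
  rw [h1, two_smul_lineProj_sub_one_mul_self hc]

end LineProj

/-! ### Points of R(Γ) as orthogonal assignments of lines; the lines around a square. -/

namespace ConnectedWeb

open Matrix

variable {D : Type*} {Γ : ConnectedWeb D}

/-- The lines of a point of the representation variety at consecutive edges of a vertex are
orthogonal. -/
theorem R.orthogonal (l : Γ.R) (d : D) :
    star (l.1 (Γ.edge d)).rep ⬝ᵥ (l.1 (Γ.edge (Γ.rot d))).rep = 0 := by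
  obtain ⟨ρ, hρ⟩ := l.2
  have hM : ∀ e, (ρ (Γ.meridian e) : Matrix (Fin 3) (Fin 3) ℂ)
      = (2 : ℂ) • lineProj (l.1 e).rep - 1 := fun e =>
    eq_two_smul_lineProj_sub_one (ρ (Γ.meridian e)).2 (hρ e).1 (l.1 e).rep_nonzero
      ((hρ e).2.trans (l.1 e).submodule_eq)
  have hrel : ∀ e₁ e₂ e₃, FreeGroup.of e₁ * FreeGroup.of e₂ * FreeGroup.of e₃ ∈ Γ.relators →
      star (l.1 e₁).rep ⬝ᵥ (l.1 e₂).rep = 0 := by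
    intro e₁ e₂ e₃ h
    have h1 : Γ.meridian e₁ * Γ.meridian e₂ * Γ.meridian e₃ = 1 :=
      PresentedGroup.one_of_mem h
    have h2 := congrArg (fun x => (ρ x : Matrix (Fin 3) (Fin 3) ℂ)) h1
    simp only [map_mul, map_one, Submonoid.coe_mul, Submonoid.coe_one, hM] at h2
    exact (orthogonal_of_reflections_mul_eq_one (l.1 _).rep_nonzero (l.1 _).rep_nonzero
      (l.1 _).rep_nonzero h2).1
  cases ho : Γ.out d with
  | false => exact hrel _ _ _ ⟨d, Or.inl ⟨ho, rfl⟩⟩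
  | true =>
    -- At a source the relator is clockwise; based at `rot (rot d)`, it starts with the edges of
    -- `rot d` and `d`.
    rw [star_dotProduct_swap, hrel _ _ (Γ.edge (Γ.rot (Γ.rot d))), star_zero]
    refine ⟨Γ.rot (Γ.rot d), Or.inr ⟨by rw [Γ.out_rot, Γ.out_rot, ho], ?_⟩⟩
    simp only [Γ.rot_rot_rot]

/-- The projections onto the lines at the edges of a vertex add up to the identity. -/
theorem R.sum_lineProj (l : Γ.R) (d : D) :
    lineProj (l.1 (Γ.edge d)).rep + lineProj (l.1 (Γ.edge (Γ.rot d))).rep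
      + lineProj (l.1 (Γ.edge (Γ.rot (Γ.rot d)))).rep = 1 := by
  refine lineProj_add_lineProj_add_lineProj (l.1 _).rep_nonzero (l.1 _).rep_nonzero
      (l.1 _).rep_nonzero (R.orthogonal l _) (R.orthogonal l _) ?_
  have := R.orthogonal l (Γ.rot (Γ.rot d))
  rwa [Γ.rot_rot_rot] at this

/-- Nonzero vectors on the edges that are orthogonal at each vertex define a point of the
representation variety. -/
theorem exists_hom_of_orthogonal (V : Γ.Edge → Fin 3 → ℂ) (hV : ∀ e, V e ≠ 0)
    (horth : ∀ d, star (V (Γ.edge d)) ⬝ᵥ V (Γ.edge (Γ.rot d)) = 0) :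
    ∃ ρ : Γ.WebGroup →* SU3, ∀ e : Γ.Edge,
      Matrix.trace (ρ (Γ.meridian e) : Matrix (Fin 3) (Fin 3) ℂ) = -1 ∧
      Module.End.eigenspace
        (Matrix.toLin' (ρ (Γ.meridian e) : Matrix (Fin 3) (Fin 3) ℂ)) 1
        = (Projectivization.mk ℂ (V e) (hV e)).submodule := by
  let f : Γ.Edge → SU3 := fun e => lineReflection (V e) (hV e)
  have horth' : ∀ d, star (V (Γ.edge (Γ.rot d))) ⬝ᵥ V (Γ.edge d) = 0 := fun d => by
    rw [star_dotProduct_swap, horth, star_zero]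
  have hclose : ∀ d, star (V (Γ.edge (Γ.rot (Γ.rot d)))) ⬝ᵥ V (Γ.edge d) = 0 := fun d => by
    have := horth (Γ.rot (Γ.rot d))
    rwa [Γ.rot_rot_rot] at this
  have hclose' : ∀ d, star (V (Γ.edge d)) ⬝ᵥ V (Γ.edge (Γ.rot (Γ.rot d))) = 0 := fun d => by
    rw [star_dotProduct_swap, hclose, star_zero]
  have hf : ∀ r ∈ Γ.relators, FreeGroup.lift f r = 1 := by
    rintro r ⟨d, ⟨-, rfl⟩ | ⟨-, rfl⟩⟩
    · simp only [map_mul, FreeGroup.lift_apply_of]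
      exact Subtype.ext (reflections_mul_eq_one (hV _) (hV _) (hV _) (horth _) (horth _)
        (hclose _))
    · simp only [map_mul, FreeGroup.lift_apply_of]
      exact Subtype.ext (reflections_mul_eq_one (hV _) (hV _) (hV _) (horth' _) (horth' _)
        (hclose' _))
  refine ⟨PresentedGroup.toGroup hf, fun e => ?_⟩
  have he : (PresentedGroup.toGroup hf (Γ.meridian e) : Matrix (Fin 3) (Fin 3) ℂ)
      = (2 : ℂ) • lineProj (V e) - 1 := by
    rw [meridian, PresentedGroup.toGroup.of]; rfl
  rw [he]
  exact ⟨trace_two_smul_lineProj_sub_one (hV e),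
    (eigenspace_two_smul_lineProj_sub_one (hV e)).trans (Projectivization.submodule_mk _ _).symm⟩

/-- In ℂ³ the orthogonal complement of two independent vectors is the line of the conjugate of their
cross product. -/
theorem parallel_of_orthogonal {a b v w : Fin 3 → ℂ} (hab : crossProduct a b ≠ 0) (hw : w ≠ 0)
    (hv0 : v ≠ 0)
    (hav : star v ⬝ᵥ a = 0) (hbv : star v ⬝ᵥ b = 0)
    (haw : star w ⬝ᵥ a = 0) (hbw : star w ⬝ᵥ b = 0) :
    Projectivization.mk ℂ v hv0 = Projectivization.mk ℂ w hw := by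
  have key : ∀ x : Fin 3 → ℂ, star x ⬝ᵥ a = 0 → star x ⬝ᵥ b = 0 →
      ∃ t : ℂ, t • crossProduct a b = star x := by
    intro x h1 h2
    by_contra hne
    have hli : LinearIndependent ℂ ![crossProduct a b, star x] := by
      rw [LinearIndependent.pair_iff' hab]
      exact fun t ht => hne ⟨t, ht⟩
    refine crossProduct_ne_zero_iff_linearIndependent.2 hli ?_
    rw [cross_cross_eq_smul_sub_smul, dotProduct_comm a, dotProduct_comm b, h1, h2]
    simp
  obtain ⟨s, hs⟩ := key v hav hbv
  obtain ⟨t, ht⟩ := key w haw hbw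
  have ht0 : t ≠ 0 := by
    rintro rfl
    rw [zero_smul] at ht
    exact hw (star_eq_zero.1 ht.symm)
  rw [Projectivization.mk_eq_mk_iff']
  refine ⟨star (s / t), ?_⟩
  apply star_injective
  rw [star_smul, star_star, ← ht, ← hs, smul_smul, div_mul_cancel₀ _ ht0]

namespace Square

variable (S : Γ.Square)

/-- The edge that carries a side of the square. -/
def sideEdge (i : ℕ) : Γ.Edge := Γ.edge (S.side i)

theorem edge_rot_rot_side_succ (i : ℕ) :
    Γ.edge (Γ.rot (Γ.rot (S.side (i + 1)))) = S.sideEdge i := by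
  rw [rot_rot_side_succ, edge_flip, sideEdge]

theorem lineProj_rot_side_succ (l : Γ.R) (i : ℕ) :
    lineProj (l.1 (Γ.edge (Γ.rot (S.side (i + 1))))).rep
      = 1 - lineProj (l.1 (S.sideEdge i)).rep - lineProj (l.1 (S.sideEdge (i + 1))).rep := by
  have := R.sum_lineProj l (S.side (i + 1))
  rw [edge_rot_rot_side_succ] at this
  rw [← this]
  simp only [sideEdge]
  abel

theorem orthogonal_sides (l : Γ.R) (i : ℕ) :
    star (l.1 (S.sideEdge i)).rep ⬝ᵥ (l.1 (S.sideEdge (i + 1))).rep = 0 := by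
  have := R.orthogonal l (Γ.rot (Γ.rot (S.side (i + 1))))
  rwa [Γ.rot_rot_rot, edge_rot_rot_side_succ] at this

/-- If sides 0 and 2 carry different lines, these span a plane, and the lines of sides 1 and 3 are
both its orthogonal complement. -/
theorem side_lines (l : Γ.R) : l.1 (S.sideEdge 0) = l.1 (S.sideEdge 2) ∨
    l.1 (S.sideEdge 1) = l.1 (S.sideEdge 3) := by
  have h01 := S.orthogonal_sides l 0
  have h12 := S.orthogonal_sides l 1
  have h23 := S.orthogonal_sides l 2
  have h30 := S.orthogonal_sides l 3
  have e4 : S.sideEdge (3 + 1) = S.sideEdge 0 := congrArg Γ.edge S.side_four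
  rw [e4] at h30
  by_cases hc : crossProduct (l.1 (S.sideEdge 0)).rep (l.1 (S.sideEdge 2)).rep = 0
  · left
    rw [← (l.1 (S.sideEdge 0)).mk_rep, ← (l.1 (S.sideEdge 2)).mk_rep,
      Projectivization.mk_eq_mk_iff']
    by_contra hne
    refine crossProduct_ne_zero_iff_linearIndependent.2 ?_ hc
    rw [LinearIndependent.pair_symm_iff, LinearIndependent.pair_iff' (l.1 _).rep_nonzero]
    exact fun t ht => hne ⟨t, ht⟩
  · right
    rw [← (l.1 (S.sideEdge 1)).mk_rep, ← (l.1 (S.sideEdge 3)).mk_rep]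
    refine parallel_of_orthogonal hc _ _ ?_ h12 h30 ?_
    · rw [star_dotProduct_swap, h01, star_zero]
    · rw [star_dotProduct_swap, h23, star_zero]

theorem lineProj_diagonal_zero (l : Γ.R) : lineProj (l.1 (Γ.edge (S.diagonal 0))).rep
    = 1 - lineProj (l.1 (S.sideEdge 3)).rep - lineProj (l.1 (S.sideEdge 0)).rep := by
  have := S.lineProj_rot_side_succ l 3
  rwa [sideEdge, sideEdge, S.side_four] at this

theorem ev_eq (l : Γ.R) : S.ev l = ![l.1 (Γ.edge (S.diagonal 0)), l.1 (Γ.edge (S.diagonal 1)),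
    l.1 (Γ.edge (S.diagonal 2)), l.1 (Γ.edge (S.diagonal 3))] := by
  ext i : 1
  fin_cases i <;> rfl

theorem ev_mem_largeDiagV_iff (l : Γ.R) : S.ev l ∈ largeDiagV ↔
    l.1 (Γ.edge (S.diagonal 0)) = l.1 (Γ.edge (S.diagonal 1)) ∧
    l.1 (Γ.edge (S.diagonal 2)) = l.1 (Γ.edge (S.diagonal 3)) := by
  rw [ev_eq]
  constructor
  · rintro ⟨u, v, h⟩
    have h0 := congrFun h 0
    have h1 := congrFun h 1
    have h2 := congrFun h 2
    have h3 := congrFun h 3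
    exact ⟨h0.trans h1.symm, h2.trans h3.symm⟩
  · rintro ⟨h1, h2⟩
    exact ⟨_, _, by rw [h1, h2]⟩

theorem ev_mem_largeDiagH_iff (l : Γ.R) : S.ev l ∈ largeDiagH ↔
    l.1 (Γ.edge (S.diagonal 0)) = l.1 (Γ.edge (S.diagonal 3)) ∧
    l.1 (Γ.edge (S.diagonal 1)) = l.1 (Γ.edge (S.diagonal 2)) := by
  rw [ev_eq]
  constructor
  · rintro ⟨u, v, h⟩
    have h0 := congrFun h 0
    have h1 := congrFun h 1
    have h2 := congrFun h 2
    have h3 := congrFun h 3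
    exact ⟨h0.trans h3.symm, h1.trans h2.symm⟩
  · rintro ⟨h1, h2⟩
    exact ⟨_, _, by rw [h1, h2]⟩

/-- The projection at a diagonal is 1 minus the projections at the two sides of its corner, so equal
opposite sides make the diagonals agree in pairs. -/
theorem ev_mem (l : Γ.R) : S.ev l ∈ largeDiagV ∨ S.ev l ∈ largeDiagH := by
  have h0 := S.lineProj_diagonal_zero l
  have h1 : lineProj (l.1 (Γ.edge (S.diagonal 1))).rep = _ := S.lineProj_rot_side_succ l 0
  have h2 : lineProj (l.1 (Γ.edge (S.diagonal 2))).rep = _ := S.lineProj_rot_side_succ l 1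
  have h3 : lineProj (l.1 (Γ.edge (S.diagonal 3))).rep = _ := S.lineProj_rot_side_succ l 2
  simp only [zero_add, Nat.reduceAdd] at h1 h2 h3
  rw [ev_mem_largeDiagV_iff, ev_mem_largeDiagH_iff]
  rcases S.side_lines l with h | h
  · right
    constructor <;> apply lineProj_rep_injective <;> dsimp only
    · rw [h0, h3, h]; abel
    · rw [h1, h2, h]; abel
  · left
    constructor <;> apply lineProj_rep_injective <;> dsimp only
    · rw [h0, h1, h]; abel
    · rw [h2, h3, h]; abel

/-- Two edges separating the same two faces, in the same direction, carry the same line. -/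
theorem line_eq_of_face_eq [Finite D] (l : Γ.R) {x y : D} (hxy : Γ.out y = !Γ.out x)
    (h1 : Γ.face x = Γ.face (Γ.flip y)) (h2 : Γ.face (Γ.flip x) = Γ.face y) :
    l.1 (Γ.edge x) = l.1 (Γ.edge y) := by
  apply lineProj_rep_injective
  ext i j
  -- Subtracting a third of the identity turns P₁ + P₂ + P₃ = 1 into conservation, entry by entry.
  -- The flow then depends only on the two faces beside an edge and on its direction.
  let P : Γ.Edge → ℂ := fun e => lineProj (l.1 e).rep i j - (1 / 3) * (1 : Matrix _ _ ℂ) i j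
  have hP : Γ.IsFlow P := by
    intro d
    have := congrFun (congrFun (R.sum_lineProj l d) i) j
    simp only [Matrix.add_apply] at this
    simp only [P]
    linear_combination this
  obtain ⟨h, hh⟩ := hP.exists_faceFlow_eq
  have key : P (Γ.edge x) = P (Γ.edge y) := by
    rw [face_flip] at h1 h2
    rw [← hh]
    cases ho : Γ.out x with
    | true =>
      rw [ho] at hxy
      rw [Γ.faceFlow_edge h ho, Γ.faceFlow_edge_of_in h hxy, h1, h2]
    | false =>
      rw [ho] at hxy
      rw [Γ.faceFlow_edge_of_in h ho, Γ.faceFlow_edge h hxy, h1, h2]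
  simpa [P] using key

theorem out_diagonal (i : ℕ) : Γ.out (Γ.rot (S.side (i + 1))) = !Γ.out (Γ.rot (S.side i)) := by
  rw [Γ.out_rot, Γ.out_rot, S.out_side_succ]

/-- Diagonals 0 and 3 both separate the common face from neighbour 3, and diagonals 1 and 2 both
separate it from neighbour 1, so each pair carries one line. -/
theorem ev_mem_largeDiagH_of_nbr_eq [Finite D] (h : S.nbr 0 = S.nbr 2) (l : Γ.R) :
    S.ev l ∈ largeDiagH := by
  rw [ev_mem_largeDiagH_iff]
  constructor
  · have ho := S.out_diagonal 3
    rw [S.side_four] at ho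
    refine (line_eq_of_face_eq l ho ?_ ?_).symm
    · rw [S.face_flip_rot_side_zero]
      exact S.face_diagonal 3
    · change _ = Γ.face (S.diagonal 0)
      rw [S.face_diagonal 0]
      exact (S.face_flip_rot_side_succ 2).trans h.symm
  · refine line_eq_of_face_eq l (S.out_diagonal 1) ?_ ?_
    · exact (S.face_diagonal 1).trans (S.face_flip_rot_side_succ 1).symm
    · refine (S.face_flip_rot_side_succ 0).trans ?_
      exact h.trans (S.face_diagonal 2).symm

theorem ev_mem_largeDiagV_of_nbr_eq [Finite D] (h : S.nbr 1 = S.nbr 3) (l : Γ.R) :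
    S.ev l ∈ largeDiagV := by
  rw [ev_mem_largeDiagV_iff]
  constructor
  · refine line_eq_of_face_eq l (S.out_diagonal 0) ?_ ?_
    · exact (S.face_diagonal 0).trans (S.face_flip_rot_side_succ 0).symm
    · refine S.face_flip_rot_side_zero.trans ?_
      exact h.symm.trans (S.face_diagonal 1).symm
  · refine line_eq_of_face_eq l (S.out_diagonal 2) ?_ ?_
    · exact (S.face_diagonal 2).trans (S.face_flip_rot_side_succ 2).symm
    · refine (S.face_flip_rot_side_succ 1).trans ?_
      exact h.trans (S.face_diagonal 3).symm

end Square

end ConnectedWeb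

/-! ### Irreducibility of analytic families in the real Zariski topology. -/

/-- Identity theorem: a zero set with nonempty interior would be the whole connected space. -/
theorem AnalyticOnNhd.dense_ne_zero {E F : Type*} [NormedAddCommGroup E] [NormedSpace ℝ E]
    [NormedAddCommGroup F] [NormedSpace ℝ F] {f : E → F} (hf : AnalyticOnNhd ℝ f Set.univ)
    {x₀ : E} (hx₀ : f x₀ ≠ 0) : Dense {x | f x ≠ 0} := by
  by_contra hd
  rw [Dense, not_forall] at hd
  obtain ⟨x, hx⟩ := hd
  rw [mem_closure_iff_frequently, Filter.not_frequently] at hx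
  refine hx₀ (hf.eqOn_zero_of_preconnected_of_eventuallyEq_zero isPreconnected_univ
    (Set.mem_univ x) ?_ (Set.mem_univ x₀))
  filter_upwards [hx] with y hy
  simpa using hy

section Zariski

open scoped Topology

variable {ι E : Type*} [NormedAddCommGroup E] [NormedSpace ℝ E] {v : E → ι → Fin 3 → ℂ}

/-- An analytic family of lines that meets a Zariski open set lies in it generically. -/
theorem exists_dense_of_isOpen_zariski
    (hv : ∀ e i, AnalyticOnNhd ℝ (fun u => v u e i) Set.univ) {O : Set (ι → CP2)}
    (hO : IsOpen[zariskiTopology ι] O) {u₀ : E} (h₀ : ∀ e, v u₀ e ≠ 0)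
    (hmem : (fun e => Projectivization.mk ℂ (v u₀ e) (h₀ e)) ∈ O) :
    ∃ G : Set E, IsOpen G ∧ Dense G ∧ ∀ u ∈ G, ∀ h : ∀ e, v u e ≠ 0,
      (fun e => Projectivization.mk ℂ (v u e) (h e)) ∈ O := by
  change TopologicalSpace.GenerateOpen _ O at hO
  induction hO with
  | univ => exact ⟨Set.univ, isOpen_univ, dense_univ, fun _ _ _ => trivial⟩
  | inter s t _ _ hs ht =>
    obtain ⟨G, hG, hG', h⟩ := hs hmem.1
    obtain ⟨G₁, hG₁, hG₁', h₁⟩ := ht hmem.2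
    exact ⟨G ∩ G₁, hG.inter hG₁, hG'.inter_of_isOpen_left hG₁' hG,
      fun u hu hne => ⟨h u hu.1 hne, h₁ u hu.2 hne⟩⟩
  | sUnion c _ ih =>
    obtain ⟨s, hs, hm⟩ := hmem
    obtain ⟨G, hG, hG', h⟩ := ih s hs hm
    exact ⟨G, hG, hG', fun u hu hne => ⟨s, hs, h u hu hne⟩⟩
  | basic s hs =>
    obtain ⟨p, rfl⟩ := hs
    simp only [Set.mem_compl_iff, Set.mem_ofPred_eq, not_forall] at hmem
    obtain ⟨w, hw, hwv, hp⟩ := hmem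
    -- The polynomial need not be homogeneous, so it may fail to vanish only at the particular
    -- coordinates `w`. The factors rescaling the family to `w` at `u₀` are kept constant in `u`,
    -- which preserves analyticity.
    have hb : ∀ e, ∃ b : ℂ, b • v u₀ e = w e := fun e =>
      (Projectivization.mk_eq_mk_iff' ℂ _ _ (hw e) (h₀ e)).1 (hwv e).symm
    choose b hb using hb
    have hb0 : ∀ e, b e ≠ 0 := by
      intro e he
      have := hb e
      rw [he, zero_smul] at this
      exact hw e this.symm
    let F : E → ℂ := fun u => MvPolynomial.eval
      (Sum.elim (fun x : ι × Fin 3 => b x.1 * v u x.1 x.2)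
        (fun x => conj (b x.1 * v u x.1 x.2))) p
    have hF : AnalyticOnNhd ℝ F Set.univ := by
      have := AnalyticOnNhd.aeval_mvPolynomial (𝕜 := ℝ) (s := (Set.univ : Set E))
        (f := fun u => Sum.elim (fun x : ι × Fin 3 => b x.1 * v u x.1 x.2)
          (fun x => conj (b x.1 * v u x.1 x.2))) (fun i => ?_) p
      · exact this
      · rcases i with x | x
        · exact analyticOnNhd_const.mul (hv x.1 x.2)
        · exact (Complex.conjCLE.toContinuousLinearMap.analyticOnNhd Set.univ).comp
            (analyticOnNhd_const.mul (hv x.1 x.2)) fun _ _ => Set.mem_univ _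
    have hF0 : F u₀ ≠ 0 := by
      have : w = fun e => b e • v u₀ e := funext fun e => (hb e).symm
      rw [this] at hp
      exact hp
    refine ⟨{u | F u ≠ 0}, isOpen_ne_fun hF.continuous continuous_const, hF.dense_ne_zero hF0,
      fun u hu hne hall => hu ?_⟩
    exact hall (fun e => b e • v u e) (fun e => smul_ne_zero (hb0 e) (hne e)) fun e => by
      rw [eq_comm, Projectivization.mk_eq_mk_iff']
      exact ⟨b e, rfl⟩

/-- Two lines coincide exactly when all 2 × 2 minors of their coordinates vanish. -/
theorem isClosed_zariski_eq (e e' : ι) : IsClosed[zariskiTopology ι] {l | l e = l e'} := by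
  let := zariskiTopology ι
  have : {l : ι → CP2 | l e = l e'} = ⋂ (i : Fin 3) (j : Fin 3),
      {l : ι → CP2 | ∀ v : ι → Fin 3 → ℂ, ∀ hv : ∀ e, v e ≠ 0,
        (∀ e, l e = Projectivization.mk ℂ (v e) (hv e)) →
        MvPolynomial.eval
          (Sum.elim (fun x : ι × Fin 3 => v x.1 x.2) (fun x : ι × Fin 3 => conj (v x.1 x.2)))
          (.X (.inl (e, i)) * .X (.inl (e', j)) - .X (.inl (e, j)) * .X (.inl (e', i))) = 0} := by
    ext l
    simp only [Set.mem_ofPred_eq, Set.mem_iInter, map_sub, map_mul, MvPolynomial.eval_X,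
      Sum.elim_inl]
    constructor
    · intro h i j v hv hl
      rw [hl, hl, Projectivization.mk_eq_mk_iff'] at h
      obtain ⟨a, ha⟩ := h
      rw [← ha]
      simp only [Pi.smul_apply, smul_eq_mul]
      ring
    · intro h
      have h' := fun i j => h i j (fun e => (l e).rep) (fun e => (l e).rep_nonzero)
        (fun e => (l e).mk_rep.symm)
      obtain ⟨j, hj⟩ := Function.ne_iff.1 (l e').rep_nonzero
      rw [← (l e).mk_rep, ← (l e').mk_rep, Projectivization.mk_eq_mk_iff']
      refine ⟨(l e).rep j / (l e').rep j, funext fun i => ?_⟩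
      simp only [Pi.zero_apply] at hj
      simp only [Pi.smul_apply, smul_eq_mul]
      field_simp
      linear_combination -h' i j
  rw [this]
  refine isClosed_iInter fun i => isClosed_iInter fun j => ⟨?_⟩
  exact TopologicalSpace.isOpen_generateFrom_of_mem ⟨_, rfl⟩

end Zariski

namespace ConnectedWeb

variable {D : Type*} {Γ : ConnectedWeb D}

/-- The points of the representation variety in an analytic family parametrized by an open set
of a real normed space form an irreducible set. -/
theorem isIrreducible_of_analytic {E : Type*} [NormedAddCommGroup E] [NormedSpace ℝ E]
    {v : E → Γ.Edge → Fin 3 → ℂ} (hv : ∀ e i, AnalyticOnNhd ℝ (fun u => v u e i) Set.univ)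
    {U : Set E} (hU : IsOpen U) (hUne : U.Nonempty) (hne : ∀ u ∈ U, ∀ e, v u e ≠ 0)
    (horth : ∀ u ∈ U, ∀ d, star (v u (Γ.edge d)) ⬝ᵥ v u (Γ.edge (Γ.rot d)) = 0) :
    IsIrreducible {l : Γ.R | ∃ u, ∃ hu : u ∈ U,
      l.1 = fun e => Projectivization.mk ℂ (v u e) (hne u hu e)} := by
  constructor
  · obtain ⟨u, hu⟩ := hUne
    exact ⟨⟨_, exists_hom_of_orthogonal (v u) (hne u hu) (horth u hu)⟩, u, hu, rfl⟩
  · rintro O₁ O₂ hO₁ hO₂ ⟨l₁, ⟨u₁, hu₁, hl₁⟩, hm₁⟩ ⟨l₂, ⟨u₂, hu₂, hl₂⟩, hm₂⟩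
    let := zariskiTopology Γ.Edge
    obtain ⟨W₁, hW₁, rfl⟩ := isOpen_induced_iff.1 hO₁
    obtain ⟨W₂, hW₂, rfl⟩ := isOpen_induced_iff.1 hO₂
    replace hm₁ : l₁.1 ∈ W₁ := hm₁
    rw [hl₁] at hm₁
    replace hm₂ : l₂.1 ∈ W₂ := hm₂
    rw [hl₂] at hm₂
    -- Density is obtained in the whole parameter space, on which the vectors are analytic, so `U`
    -- need not be connected.
    obtain ⟨G₁, hG₁, hd₁, h₁⟩ := exists_dense_of_isOpen_zariski hv hW₁ _ hm₁
    obtain ⟨G₂, hG₂, hd₂, h₂⟩ := exists_dense_of_isOpen_zariski hv hW₂ _ hm₂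
    obtain ⟨u, hu, hg₁, hg₂⟩ := (hd₁.inter_of_isOpen_left hd₂ hG₁).inter_open_nonempty U hU hUne
    exact ⟨⟨_, exists_hom_of_orthogonal (v u) (hne u hu) (horth u hu)⟩, ⟨u, hu, rfl⟩,
      h₁ u hg₁ (hne u hu), h₂ u hg₂ (hne u hu)⟩

theorem isClosed_line_eq (e e' : Γ.Edge) : IsClosed {l : Γ.R | l.1 e = l.1 e'} := by
  let := zariskiTopology Γ.Edge
  exact (isClosed_zariski_eq e e').preimage continuous_induced_dom

namespace Square

variable (S : Γ.Square)

theorem isClosed_ev_largeDiagV : IsClosed {l : Γ.R | S.ev l ∈ largeDiagV} := by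
  simp only [ev_mem_largeDiagV_iff]
  exact (isClosed_line_eq _ _).inter (isClosed_line_eq _ _)

theorem isClosed_ev_largeDiagH : IsClosed {l : Γ.R | S.ev l ∈ largeDiagH} := by
  simp only [ev_mem_largeDiagH_iff]
  exact (isClosed_line_eq _ _).inter (isClosed_line_eq _ _)

/-- Two closed sets cover R(Γ) by `ev_mem`, so an irreducible set, in particular a component, lies
in one of them. -/
theorem exists_mem_irreducibleComponents {Z : Set Γ.R} (hZ : IsIrreducible Z) :
    ∃ C ∈ irreducibleComponents Γ.R, Z ⊆ C ∧
      (S.ev '' C ⊆ largeDiagV ∨ S.ev '' C ⊆ largeDiagH) := by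
  obtain ⟨C, hC, hZC, hmax⟩ := exists_preirreducible Z hZ.2
  refine ⟨C, ⟨⟨hZ.1.mono hZC, hC⟩, fun T hT hCT => (hmax T hT.2 hCT).le⟩, hZC, ?_⟩
  simp only [Set.image_subset_iff]
  exact isPreirreducible_iff_isClosed_union_isClosed.1 hC _ _ S.isClosed_ev_largeDiagV
    S.isClosed_ev_largeDiagH fun l _ => S.ev_mem l

end Square

end ConnectedWeb

/-! ### Pairs of orthogonal frames with a common vector. -/

section KempeFrame

open Matrix

/-- The space of parameters for a pair of orthogonal frames with a common vector. -/
abbrev KempeParam : Type := (Fin 3 → ℂ) × (Fin 3 → ℂ) × ℂ × ℂ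

namespace KempeParam

/-- The common vector of the two frames. -/
def axis (u : KempeParam) : Fin 3 → ℂ := star (crossProduct u.1 u.2.1)

/-- The third vector of the first frame. -/
def normal (u : KempeParam) : Fin 3 → ℂ := star (crossProduct u.axis u.1)

/-- The second vector of the second frame. -/
def rotated (u : KempeParam) : Fin 3 → ℂ := u.2.2.1 • u.1 + u.2.2.2 • u.normal

/-- The third vector of the second frame. -/
def rotatedNormal (u : KempeParam) : Fin 3 → ℂ := star (crossProduct u.axis u.rotated)

/-- The parameters for which the two frames are nondegenerate. -/
def nondegenerate : Set KempeParam := {u | crossProduct u.1 u.2.1 ≠ 0 ∧ u.2.2 ≠ 0}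

/-- The two frames, indexed so that the common vector has index `k` and the second vector has
index `j`. -/
def frame (k j : ZMod 3) (b : Prop) [Decidable b] (i : ZMod 3) (u : KempeParam) : Fin 3 → ℂ :=
  if i = k then u.axis
  else if i = j then (if b then u.rotated else u.1)
  else (if b then u.rotatedNormal else u.normal)

theorem frame_congr (u : KempeParam) (k j : ZMod 3) {b b' : Prop} [Decidable b] [Decidable b']
    (h : b ↔ b') (i : ZMod 3) : u.frame k j b i = u.frame k j b' i := by
  simp only [frame, h]

section Analytic

variable {f g : KempeParam → Fin 3 → ℂ}

theorem analytic_cross (hf : ∀ i, AnalyticOnNhd ℝ (fun u => f u i) Set.univ)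
    (hg : ∀ i, AnalyticOnNhd ℝ (fun u => g u i) Set.univ) (i : Fin 3) :
    AnalyticOnNhd ℝ (fun u => crossProduct (f u) (g u) i) Set.univ := by
  fin_cases i <;> simp only [cross_apply]
  · exact ((hf 1).mul (hg 2)).sub ((hf 2).mul (hg 1))
  · exact ((hf 2).mul (hg 0)).sub ((hf 0).mul (hg 2))
  · exact ((hf 0).mul (hg 1)).sub ((hf 1).mul (hg 0))

theorem analytic_star (hf : ∀ i, AnalyticOnNhd ℝ (fun u => f u i) Set.univ) (i : Fin 3) :
    AnalyticOnNhd ℝ (fun u => star (f u) i) Set.univ :=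
  (Complex.conjCLE.toContinuousLinearMap.analyticOnNhd Set.univ).comp (hf i)
    fun _ _ => Set.mem_univ _

theorem analytic_fst (i : Fin 3) : AnalyticOnNhd ℝ (fun u : KempeParam => u.1 i) Set.univ :=
  let L : KempeParam →L[ℝ] ℂ := (ContinuousLinearMap.proj i).comp (ContinuousLinearMap.fst ℝ _ _)
  L.analyticOnNhd _

theorem analytic_snd (i : Fin 3) : AnalyticOnNhd ℝ (fun u : KempeParam => u.2.1 i) Set.univ :=
  let L : KempeParam →L[ℝ] ℂ := (ContinuousLinearMap.proj i).comp
    ((ContinuousLinearMap.fst ℝ _ _).comp (ContinuousLinearMap.snd ℝ _ _))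
  L.analyticOnNhd _

theorem analytic_axis (i : Fin 3) :
    AnalyticOnNhd ℝ (fun u : KempeParam => u.axis i) Set.univ :=
  analytic_star (analytic_cross analytic_fst analytic_snd) i

theorem analytic_normal (i : Fin 3) :
    AnalyticOnNhd ℝ (fun u : KempeParam => u.normal i) Set.univ :=
  analytic_star (analytic_cross analytic_axis analytic_fst) i

theorem analytic_rotated (i : Fin 3) :
    AnalyticOnNhd ℝ (fun u : KempeParam => u.rotated i) Set.univ := by
  have h1 : AnalyticOnNhd ℝ (fun u : KempeParam => u.2.2.1) Set.univ := fun _ _ =>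
    analyticAt_fst.comp (analyticAt_snd.comp analyticAt_snd)
  have h2 : AnalyticOnNhd ℝ (fun u : KempeParam => u.2.2.2) Set.univ := fun _ _ =>
    analyticAt_snd.comp (analyticAt_snd.comp analyticAt_snd)
  exact (h1.mul (analytic_fst i)).add (h2.mul (analytic_normal i))

theorem analytic_rotatedNormal (i : Fin 3) :
    AnalyticOnNhd ℝ (fun u : KempeParam => u.rotatedNormal i) Set.univ :=
  analytic_star (analytic_cross analytic_axis analytic_rotated) i

theorem analytic_frame (k j : ZMod 3) (b : Prop) [Decidable b] (m : ZMod 3) (i : Fin 3) :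
    AnalyticOnNhd ℝ (fun u : KempeParam => u.frame k j b m i) Set.univ := by
  unfold frame
  split_ifs
  exacts [analytic_axis i, analytic_rotated i, analytic_fst i, analytic_rotatedNormal i,
    analytic_normal i]

theorem isOpen_nondegenerate : IsOpen nondegenerate := by
  have h : Continuous fun u : KempeParam => crossProduct u.1 u.2.1 :=
    continuous_pi fun i => (analytic_cross analytic_fst analytic_snd i).continuous
  exact (isOpen_ne_fun h continuous_const).inter (isOpen_ne_fun (by fun_prop) continuous_const)

end Analytic

/-- By the triple product formula, (a × b) × ā = |a|² b when a and b are orthogonal. -/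
theorem cross_ne_zero_of_orthogonal {a b : Fin 3 → ℂ} (ha : a ≠ 0) (hb : b ≠ 0)
    (hab : star a ⬝ᵥ b = 0) : crossProduct a b ≠ 0 := by
  intro h
  have := cross_cross_eq_smul_sub_smul a b (star a)
  rw [h, dotProduct_comm b, hab, dotProduct_comm a, zero_smul, sub_zero, map_zero,
    LinearMap.zero_apply] at this
  exact (smul_ne_zero (star_dotProduct_self_ne_zero ha) hb) this.symm

theorem star_cross_dotProduct_left (a b : Fin 3 → ℂ) : star (star (crossProduct a b)) ⬝ᵥ a = 0 := by
  rw [star_star, dotProduct_comm, dot_self_cross]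

theorem star_cross_dotProduct_right (a b : Fin 3 → ℂ) :
    star (star (crossProduct a b)) ⬝ᵥ b = 0 := by
  rw [star_star, dotProduct_comm, dot_cross_self]

theorem orthogonal_symm {a b : Fin 3 → ℂ} (h : star a ⬝ᵥ b = 0) : star b ⬝ᵥ a = 0 := by
  rw [star_dotProduct_swap, h, star_zero]

variable {u : KempeParam}

theorem axis_orthogonal_rotated (u : KempeParam) : star u.axis ⬝ᵥ u.rotated = 0 := by
  have h1 : star u.axis ⬝ᵥ u.1 = 0 := star_cross_dotProduct_left _ _
  have h2 : star u.axis ⬝ᵥ u.normal = 0 := orthogonal_symm (star_cross_dotProduct_left _ _)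
  rw [rotated, dotProduct_add, dotProduct_smul, dotProduct_smul, h1, h2]
  simp

theorem fst_ne_zero (hu : u ∈ nondegenerate) : u.1 ≠ 0 := fun h => hu.1 (by simp [h])

theorem axis_ne_zero (hu : u ∈ nondegenerate) : u.axis ≠ 0 := star_ne_zero.2 hu.1

theorem normal_ne_zero (hu : u ∈ nondegenerate) : u.normal ≠ 0 :=
  star_ne_zero.2 (cross_ne_zero_of_orthogonal (axis_ne_zero hu) (fst_ne_zero hu)
    (star_cross_dotProduct_left _ _))

theorem rotated_ne_zero (hu : u ∈ nondegenerate) : u.rotated ≠ 0 := by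
  intro h
  have h1 := congrArg (star u.1 ⬝ᵥ ·) h
  have h2 := congrArg (star u.normal ⬝ᵥ ·) h
  have h3 : star u.normal ⬝ᵥ u.1 = 0 := star_cross_dotProduct_right _ _
  simp only [rotated, dotProduct_add, dotProduct_smul, h3, orthogonal_symm h3, dotProduct_zero,
    smul_eq_mul, mul_zero, add_zero, zero_add] at h1 h2
  exact hu.2 (Prod.ext
    ((mul_eq_zero.1 h1).resolve_right (star_dotProduct_self_ne_zero (fst_ne_zero hu)))
    ((mul_eq_zero.1 h2).resolve_right (star_dotProduct_self_ne_zero (normal_ne_zero hu))))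

theorem rotatedNormal_ne_zero (hu : u ∈ nondegenerate) : u.rotatedNormal ≠ 0 :=
  star_ne_zero.2 (cross_ne_zero_of_orthogonal (axis_ne_zero hu) (rotated_ne_zero hu)
    (axis_orthogonal_rotated u))

theorem frame_ne_zero (hu : u ∈ nondegenerate) (k j : ZMod 3) (b : Prop) [Decidable b]
    (m : ZMod 3) : u.frame k j b m ≠ 0 := by
  unfold frame
  split_ifs
  exacts [axis_ne_zero hu, rotated_ne_zero hu, fst_ne_zero hu, rotatedNormal_ne_zero hu,
    normal_ne_zero hu]

theorem frame_orthogonal (u : KempeParam) {k j : ZMod 3} (hjk : j ≠ k) (b : Prop) [Decidable b]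
    {m m' : ZMod 3} (hm : m ≠ m') : star (u.frame k j b m) ⬝ᵥ u.frame k j b m' = 0 := by
  have h1 : star u.axis ⬝ᵥ u.1 = 0 := star_cross_dotProduct_left _ _
  have h2 : star u.normal ⬝ᵥ u.axis = 0 := star_cross_dotProduct_left _ _
  have h3 : star u.normal ⬝ᵥ u.1 = 0 := star_cross_dotProduct_right _ _
  have h4 := axis_orthogonal_rotated u
  have h5 : star u.rotatedNormal ⬝ᵥ u.axis = 0 := star_cross_dotProduct_left _ _
  have h6 : star u.rotatedNormal ⬝ᵥ u.rotated = 0 := star_cross_dotProduct_right _ _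
  have hcol : m = k ∨ m = j ∨ m' = k ∨ m' = j := by
    revert k j m m'; decide
  unfold frame
  split_ifs <;> first
    | assumption
    | (apply orthogonal_symm; assumption)
    | (exfalso; grind)

/-- The second vectors of the two frames can be prescribed independently; this makes the family fill
all of Δ_v or Δ_h. -/
theorem exists_lines (a b : CP2) : ∃ u ∈ nondegenerate, ∃ (h1 : u.rotated ≠ 0) (h2 : u.1 ≠ 0),
    Projectivization.mk ℂ u.rotated h1 = a ∧ Projectivization.mk ℂ u.1 h2 = b := by
  by_cases hc : crossProduct b.rep a.rep = 0
  · obtain ⟨w, hw⟩ : ∃ w, crossProduct b.rep w ≠ 0 := by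
      by_contra! hall
      apply b.rep_nonzero
      have h0 := hall (Pi.single 0 1)
      have h1 := hall (Pi.single 1 1)
      have e1 := congrFun h0 1
      have e2 := congrFun h0 2
      have e3 := congrFun h1 2
      simp [cross_apply] at e1 e2 e3
      ext i
      fin_cases i
      exacts [e3, e2, e1]
    let u : KempeParam := (b.rep, w, 1, 0)
    have hu : u ∈ nondegenerate := ⟨hw, by simp [u]⟩
    have hr : u.rotated = b.rep := by simp [rotated, u]
    have hab : b = a := by
      by_contra hne
      refine crossProduct_ne_zero_iff_linearIndependent.2 ?_ hc
      rw [LinearIndependent.pair_symm_iff, LinearIndependent.pair_iff' a.rep_nonzero]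
      intro t ht
      apply hne
      rw [← a.mk_rep, ← b.mk_rep, Projectivization.mk_eq_mk_iff']
      exact ⟨t, ht⟩
    refine ⟨u, hu, rotated_ne_zero hu, fst_ne_zero hu, ?_, b.mk_rep⟩
    simp only [hr, Projectivization.mk_rep, hab]
  -- Gram–Schmidt: here the normal is |b|² a - ⟨b, a⟩ b, so the coefficients ⟨b, a⟩ and 1 make the
  -- rotated vector |b|² a.
  · let u : KempeParam := (b.rep, a.rep, star b.rep ⬝ᵥ a.rep, 1)
    have hu : u ∈ nondegenerate := ⟨hc, by simp [u]⟩
    have hstar : ∀ x y : Fin 3 → ℂ, star (crossProduct x y) = crossProduct (star x) (star y) := by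
      intro x y
      ext i
      fin_cases i <;> simp [cross_apply]
    have hr : u.rotated = (star b.rep ⬝ᵥ b.rep) • a.rep := by
      rw [rotated, normal, axis, hstar (star _), star_star, cross_cross_eq_smul_sub_smul]
      simp only [u, one_smul]
      rw [dotProduct_comm b.rep, dotProduct_comm a.rep]
      abel
    refine ⟨u, hu, rotated_ne_zero hu, fst_ne_zero hu, ?_, b.mk_rep⟩
    conv_rhs => rw [← a.mk_rep]
    rw [Projectivization.mk_eq_mk_iff']
    exact ⟨_, hr.symm⟩

end KempeParam

end KempeFrame

/-! ### Kempe moves along a face and the big components. -/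

namespace ConnectedWeb

open Matrix

variable {D : Type*} {Γ : ConnectedWeb D}

/-- A proper colouring of the faces with three colours, increasing around sources and decreasing
around sinks. -/
def IsFaceColouring (h : Γ.Face → ZMod 3) : Prop :=
  (∀ d, Γ.out d = true → h (Γ.face (Γ.rot d)) = h (Γ.face d) + 1) ∧
  (∀ d, Γ.out d = false → h (Γ.face (Γ.rot d)) = h (Γ.face d) - 1)

/-- The edge colouring induced by a face colouring: an edge gets the colour that is missing from
the two faces it separates. -/
noncomputable def edgeColour (h : Γ.Face → ZMod 3) (e : Γ.Edge) : ZMod 3 :=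
  -(h (Γ.face (Γ.outDart e)) + h (Γ.face (Γ.flip (Γ.outDart e))))

/-- The edge lies on the boundary of the face. -/
def Borders (e : Γ.Edge) (N : Γ.Face) : Prop :=
  ∃ d, Γ.edge d = e ∧ Γ.face d = N

theorem borders_edge_iff {d : D} {N : Γ.Face} :
    Borders (Γ.edge d) N ↔ Γ.face d = N ∨ Γ.face (Γ.flip d) = N := by
  constructor
  · rintro ⟨x, hx, rfl⟩
    rcases Γ.edge_eq_iff.1 hx with rfl | rfl
    · exact Or.inl rfl
    · rw [Γ.flip_flip]; exact Or.inr rfl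
  · rintro (h | h)
    · exact ⟨d, rfl, h⟩
    · exact ⟨Γ.flip d, Γ.edge_flip d, h⟩

theorem IsFaceColouring.ne {h : Γ.Face → ZMod 3} (hh : IsFaceColouring h) (d : D) :
    h (Γ.face (Γ.rot d)) ≠ h (Γ.face d) := by
  cases ho : Γ.out d with
  | true => rw [hh.1 d ho]; generalize h _ = a; revert a; decide
  | false => rw [hh.2 d ho]; generalize h _ = a; revert a; decide

/-- The three faces at a vertex have the three colours, which sum to 0 modulo 3, so the missing
colour is that of the face opposite the edge. -/
theorem IsFaceColouring.edgeColour_edge {h : Γ.Face → ZMod 3} (hh : IsFaceColouring h) (d : D) :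
    edgeColour h (Γ.edge d) = h (Γ.face (Γ.rot (Γ.rot d))) := by
  have h1 : edgeColour h (Γ.edge d) = -(h (Γ.face d) + h (Γ.face (Γ.rot d))) := by
    rw [edgeColour, ← face_flip]
    rcases Γ.edge_eq_iff.1 (Γ.edge_outDart (Γ.edge d)) with e | e
    · rw [← e]
    · have e' : Γ.flip d = Γ.outDart (Γ.edge d) := by
        conv_lhs => rw [e, Γ.flip_flip]
      rw [← e', Γ.flip_flip, add_comm]
  rw [h1]
  cases ho : Γ.out d with
  | true =>
    rw [hh.1 (Γ.rot d) (by rw [Γ.out_rot, ho]), hh.1 d ho]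
    generalize h _ = a; revert a; decide
  | false =>
    rw [hh.2 (Γ.rot d) (by rw [Γ.out_rot, ho]), hh.2 d ho]
    generalize h _ = a; revert a; decide

open Classical in
/-- The family of vectors obtained from an edge colouring by rotating two of the colours along the
boundary of a face. -/
noncomputable def kempeFamily (h : Γ.Face → ZMod 3) (N : Γ.Face) (j : ZMod 3) (u : KempeParam)
    (e : Γ.Edge) : Fin 3 → ℂ :=
  u.frame (h N) j (Borders e N) (edgeColour h e)

/-- At a vertex of N, the edge opposite N has the colour of N and carries the common axis, while the
other two edges border N and use the rotated frame. At a vertex off N, every edge whose colour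
differs from that of N uses the original frame. So each vertex sees a single orthogonal frame. -/
theorem kempeFamily_orthogonal {h : Γ.Face → ZMod 3} (hh : IsFaceColouring h) {N : Γ.Face}
    {j : ZMod 3} (hj : j ≠ h N) (u : KempeParam) (d : D) :
    star (kempeFamily h N j u (Γ.edge d)) ⬝ᵥ kempeFamily h N j u (Γ.edge (Γ.rot d)) = 0 := by
  classical
  let touches : D → Prop := fun x =>
    Γ.face x = N ∨ Γ.face (Γ.rot x) = N ∨ Γ.face (Γ.rot (Γ.rot x)) = N
  have key : ∀ x, kempeFamily h N j u (Γ.edge x)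
      = u.frame (h N) j (touches x) (edgeColour h (Γ.edge x)) := by
    intro x
    by_cases hc : edgeColour h (Γ.edge x) = h N
    · rw [kempeFamily, KempeParam.frame, KempeParam.frame, if_pos hc, if_pos hc]
    · have hN : Γ.face (Γ.rot (Γ.rot x)) ≠ N := by
        rintro rfl
        exact hc (hh.edgeColour_edge x)
      have : Borders (Γ.edge x) N ↔ touches x := by
        rw [borders_edge_iff, face_flip]
        simp only [touches]
        tauto
      exact KempeParam.frame_congr u _ _ this _
  have ht : touches (Γ.rot d) ↔ touches d := by
    simp only [touches, Γ.rot_rot_rot]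
    tauto
  rw [key, key, u.frame_congr _ _ ht]
  refine u.frame_orthogonal hj _ ?_
  rw [hh.edgeColour_edge, hh.edgeColour_edge, Γ.rot_rot_rot]
  have := hh.ne (Γ.rot (Γ.rot d))
  rw [Γ.rot_rot_rot] at this
  exact this.symm

namespace Square

variable (S : Γ.Square)

theorem edgeColour_diagonal {h : Γ.Face → ZMod 3} (hh : IsFaceColouring h) (i : Fin 4) :
    edgeColour h (Γ.edge (S.diagonal i)) = h (Γ.face S.base) := by
  rw [hh.edgeColour_edge, diagonal, Γ.rot_rot_rot, ← S.face_side i, side]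

theorem nbr_colour_ne {h : Γ.Face → ZMod 3} (hh : IsFaceColouring h) (i : ℕ) :
    h (Γ.face S.base) ≠ h (S.nbr i) := by
  rw [← S.face_side i, nbr_eq]
  exact (hh.ne _).symm

open Classical in
/-- There is a component on which the lines of the diagonals bordering a neighbour of the square
and those of the other diagonals are arbitrary. -/
theorem exists_component [Finite D] (n : ℕ) : ∃ C ∈ irreducibleComponents Γ.R,
    (S.ev '' C ⊆ largeDiagV ∨ S.ev '' C ⊆ largeDiagH) ∧
    ∀ a b : CP2, ∃ l ∈ C, ∀ i,
      S.ev l i = if Borders (Γ.edge (S.diagonal i)) (S.nbr n) then a else b := by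
  obtain ⟨h, hh⟩ := Γ.exists_face_colouring
  replace hh : IsFaceColouring h := hh
  have hj := S.nbr_colour_ne hh n
  have hne : ∀ u ∈ KempeParam.nondegenerate, ∀ e,
      kempeFamily h (S.nbr n) (h (Γ.face S.base)) u e ≠ 0 := fun u hu e =>
    KempeParam.frame_ne_zero hu _ _ _ _
  have horth : ∀ u ∈ KempeParam.nondegenerate, ∀ d,
      star (kempeFamily h (S.nbr n) (h (Γ.face S.base)) u (Γ.edge d)) ⬝ᵥ
        kempeFamily h (S.nbr n) (h (Γ.face S.base)) u (Γ.edge (Γ.rot d)) = 0 := fun u _ d =>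
    kempeFamily_orthogonal hh hj u d
  obtain ⟨u₀, hu₀, -⟩ := KempeParam.exists_lines (Projectivization.mk ℂ 1 one_ne_zero)
    (Projectivization.mk ℂ 1 one_ne_zero)
  have hirr := isIrreducible_of_analytic
    (v := fun u => kempeFamily h (S.nbr n) (h (Γ.face S.base)) u)
    (fun e i => KempeParam.analytic_frame _ _ _ _ i) KempeParam.isOpen_nondegenerate
    ⟨u₀, hu₀⟩ hne horth
  obtain ⟨C, hC, hZC, hVH⟩ := S.exists_mem_irreducibleComponents hirr
  refine ⟨C, hC, hVH, fun a b => ?_⟩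
  obtain ⟨u, hu, h1, h2, ha, hb⟩ := KempeParam.exists_lines a b
  refine ⟨⟨_, exists_hom_of_orthogonal _ (hne u hu) (horth u hu)⟩, hZC ⟨u, hu, rfl⟩, fun i => ?_⟩
  -- All diagonals have the colour of the square, which serves as the index `j`, so each carries the
  -- second vector of one of the two frames.
  have hfam : kempeFamily h (S.nbr n) (h (Γ.face S.base)) u (Γ.edge (S.diagonal i))
      = if Borders (Γ.edge (S.diagonal i)) (S.nbr n) then u.rotated else u.1 := by
    rw [kempeFamily, KempeParam.frame, S.edgeColour_diagonal hh, if_neg hj, if_pos rfl]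
  change Projectivization.mk ℂ (kempeFamily h (S.nbr n) (h (Γ.face S.base)) u
    (Γ.edge (S.diagonal i))) _ = _
  by_cases hB : Borders (Γ.edge (S.diagonal i)) (S.nbr n)
  · simp only [hfam, if_pos hB, ha]
  · simp only [hfam, if_neg hB, hb]

theorem borders_diagonal_succ_iff (i : ℕ) (N : Γ.Face) :
    Borders (Γ.edge (Γ.rot (S.side (i + 1)))) N ↔ S.nbr (i + 1) = N ∨ S.nbr i = N := by
  rw [borders_edge_iff, face_flip_rot_side_succ, ← nbr_eq]

theorem borders_diagonal_zero_iff (N : Γ.Face) :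
    Borders (Γ.edge (S.diagonal 0)) N ↔ S.nbr 0 = N ∨ S.nbr 3 = N := by
  rw [borders_edge_iff, face_diagonal]
  exact or_congr Iff.rfl (by rw [← S.face_flip_rot_side_zero]; rfl)

theorem exists_ne_line : ∃ a b : CP2, a ≠ b := by
  have h1 : (![1, 0, 0] : Fin 3 → ℂ) ≠ 0 := fun h => by simpa using congrFun h 0
  have h2 : (![0, 1, 0] : Fin 3 → ℂ) ≠ 0 := fun h => by simpa using congrFun h 1
  refine ⟨Projectivization.mk ℂ _ h1, Projectivization.mk ℂ _ h2, fun h => ?_⟩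
  rw [Projectivization.mk_eq_mk_iff'] at h
  obtain ⟨t, ht⟩ := h
  simpa using congrFun ht 0

/-- The Kempe move along neighbour 3 moves diagonals 0 and 3; the hypothesis keeps diagonals 1 and 2
off its boundary. The image of the component contains Δ_h, and a point with two distinct lines
excludes Δ_v as its bound. -/
theorem exists_component_largeDiagH [Finite D] (h13 : S.nbr 1 ≠ S.nbr 3) :
    ∃ C ∈ irreducibleComponents Γ.R, S.ev '' C = largeDiagH := by
  classical
  obtain ⟨C, hC, hVH, hab⟩ := S.exists_component 3
  have h01 := S.nbr_three_ne_zero.symm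
  have h23 := S.nbr_ne_succ 2
  have e0 := S.borders_diagonal_zero_iff (S.nbr 3)
  have e1 : Borders (Γ.edge (S.diagonal 1)) (S.nbr 3) ↔ _ := S.borders_diagonal_succ_iff 0 _
  have e2 : Borders (Γ.edge (S.diagonal 2)) (S.nbr 3) ↔ _ := S.borders_diagonal_succ_iff 1 _
  have e3 : Borders (Γ.edge (S.diagonal 3)) (S.nbr 3) ↔ _ := S.borders_diagonal_succ_iff 2 _
  have hev : ∀ a b : CP2, ∃ l ∈ C, S.ev l = ![a, b, b, a] := by
    intro a b
    obtain ⟨l, hl, hi⟩ := hab a b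
    refine ⟨l, hl, funext fun i => ?_⟩
    rw [hi]
    fin_cases i
    · exact if_pos (e0.2 (Or.inr rfl))
    · exact if_neg (fun h => (e1.1 h).elim h13 h01)
    · exact if_neg (fun h => (e2.1 h).elim h23 h13)
    · exact if_pos (e3.2 (Or.inl rfl))
  have hsub : largeDiagH ⊆ S.ev '' C := by
    rintro _ ⟨a, b, rfl⟩
    exact hev a b
  refine ⟨C, hC, (hVH.resolve_left fun hV => ?_).antisymm hsub⟩
  obtain ⟨a, b, hne⟩ := exists_ne_line
  obtain ⟨p, q, hpq⟩ := hV (hsub ⟨a, b, rfl⟩)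
  exact hne ((congrFun hpq 0).trans (congrFun hpq 1).symm)

/-- The same with the move along neighbour 0, which borders diagonals 0 and 1 only. -/
theorem exists_component_largeDiagV [Finite D] (h02 : S.nbr 0 ≠ S.nbr 2) :
    ∃ C ∈ irreducibleComponents Γ.R, S.ev '' C = largeDiagV := by
  classical
  obtain ⟨C, hC, hVH, hab⟩ := S.exists_component 0
  have h01 := S.nbr_ne_succ 0
  have h30 := S.nbr_three_ne_zero
  have e0 := S.borders_diagonal_zero_iff (S.nbr 0)
  have e1 : Borders (Γ.edge (S.diagonal 1)) (S.nbr 0) ↔ _ := S.borders_diagonal_succ_iff 0 _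
  have e2 : Borders (Γ.edge (S.diagonal 2)) (S.nbr 0) ↔ _ := S.borders_diagonal_succ_iff 1 _
  have e3 : Borders (Γ.edge (S.diagonal 3)) (S.nbr 0) ↔ _ := S.borders_diagonal_succ_iff 2 _
  have hev : ∀ a b : CP2, ∃ l ∈ C, S.ev l = ![a, a, b, b] := by
    intro a b
    obtain ⟨l, hl, hi⟩ := hab a b
    refine ⟨l, hl, funext fun i => ?_⟩
    rw [hi]
    fin_cases i
    · exact if_pos (e0.2 (Or.inl rfl))
    · exact if_pos (e1.2 (Or.inr rfl))
    · exact if_neg (fun h => (e2.1 h).elim h02.symm h01.symm)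
    · exact if_neg (fun h => (e3.1 h).elim h30 h02.symm)
  have hsub : largeDiagV ⊆ S.ev '' C := by
    rintro _ ⟨a, b, rfl⟩
    exact hev a b
  refine ⟨C, hC, (hVH.resolve_right fun hH => ?_).antisymm hsub⟩
  obtain ⟨a, b, hne⟩ := exists_ne_line
  obtain ⟨p, q, hpq⟩ := hH (hsub ⟨a, b, rfl⟩)
  exact hne ((congrFun hpq 1).trans (congrFun hpq 2).symm)

end Square

end ConnectedWeb

/-! ### The small diagonal and the conclusion. -/

theorem smallDiag_subset_largeDiagV : smallDiag ⊆ largeDiagV := fun _ ⟨u, hu⟩ => ⟨u, u, hu⟩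

theorem smallDiag_subset_largeDiagH : smallDiag ⊆ largeDiagH := fun _ ⟨u, hu⟩ => ⟨u, u, hu⟩

theorem largeDiagV_inter_largeDiagH_subset : largeDiagV ∩ largeDiagH ⊆ smallDiag := by
  rintro _ ⟨⟨u, v, rfl⟩, ⟨u', v', h⟩⟩
  have h0 : u = u' := congrFun h 0
  have h3 : v = u' := congrFun h 3
  exact ⟨u, by rw [h3, h0]⟩

theorem mainTheorem4 {D : Type*} [Finite D] (Γ : ConnectedWeb D) (S : Γ.Square) :
    (S.IsSeparating →
      ((∃ C ∈ irreducibleComponents Γ.R, S.IsBig C ∧ S.ev '' C = largeDiagV) ∧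
        largeDiagH ∩ Set.range S.ev = smallDiag) ∨
      ((∃ C ∈ irreducibleComponents Γ.R, S.IsBig C ∧ S.ev '' C = largeDiagH) ∧
        largeDiagV ∩ Set.range S.ev = smallDiag)) ∧
    (¬ S.IsSeparating →
      (∃ C ∈ irreducibleComponents Γ.R, S.IsBig C ∧ S.ev '' C = largeDiagV) ∧
      (∃ C ∈ irreducibleComponents Γ.R, S.IsBig C ∧ S.ev '' C = largeDiagH)) := by
  have hV : S.nbr 0 ≠ S.nbr 2 →
      ∃ C ∈ irreducibleComponents Γ.R, S.IsBig C ∧ S.ev '' C = largeDiagV := fun h =>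
    let ⟨C, hC, hev⟩ := S.exists_component_largeDiagV h
    ⟨C, hC, Or.inl hev, hev⟩
  have hH : S.nbr 1 ≠ S.nbr 3 →
      ∃ C ∈ irreducibleComponents Γ.R, S.IsBig C ∧ S.ev '' C = largeDiagH := fun h =>
    let ⟨C, hC, hev⟩ := S.exists_component_largeDiagH h
    ⟨C, hC, Or.inr hev, hev⟩
  rw [S.isSeparating_iff, not_or]
  refine ⟨?_, fun h => ⟨hV h.1, hH h.2⟩⟩
  rintro (h | h)
  -- Neighbours 0 and 2 coincide, so all of R(Γ) maps into Δ_h, while neighbours 1 and 3 differ, so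
  -- some component fills Δ_h and in particular reaches δ.
  · right
    have hC := hH (S.nbr_ne_of_nbr_eq h)
    refine ⟨hC, Set.Subset.antisymm ?_ fun x hx => ⟨smallDiag_subset_largeDiagV hx, ?_⟩⟩
    · rintro _ ⟨hx, l, rfl⟩
      exact largeDiagV_inter_largeDiagH_subset ⟨hx, S.ev_mem_largeDiagH_of_nbr_eq h l⟩
    · obtain ⟨C, -, -, hev⟩ := hC
      exact Set.image_subset_range _ C (hev ▸ smallDiag_subset_largeDiagH hx)
  · left
    have hC := hV fun h' => S.nbr_ne_of_nbr_eq h' h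
    refine ⟨hC, Set.Subset.antisymm ?_ fun x hx => ⟨smallDiag_subset_largeDiagH hx, ?_⟩⟩
    · rintro _ ⟨hx, l, rfl⟩
      exact largeDiagV_inter_largeDiagH_subset ⟨S.ev_mem_largeDiagV_of_nbr_eq h l, hx⟩
    · obtain ⟨C, -, -, hev⟩ := hC
      exact Set.image_subset_range _ C (hev ▸ smallDiag_subset_largeDiagV hx)
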